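/- **Conventions.** $I=D=[0,1]$, $D^n$ is the closed unit ball of $\mathbb{R}^n$, and maps are continuous. A *1-complex* is (the underlying space of) a finite simplicial complex of dimension at most $1$. An *ANR* is a metrizable space $X$ such that whenever $X$ is embedded as a closed subset of a metrizable space $Y$, some open neighbourhood of $X$ in $Y$ retracts onto $X$. For maps into a metric space, "$f$ can be approximated by maps with a property" means that for every $\varepsilon>0$ there is a map $f'$ with that property and with $\rho(f'(z),f(z))<\varepsilon$ for all $z$ (for two maps simultaneously, likewise). A metric space $X$ has the *$(m,n)$-DDP* if any two maps $D^m\to X$, $D^n\to X$ can be approximated by maps with disjoint images. The *DAP* (disjoint arcs property) is the $(1,1)$-DDP and the *DDP* is the $(2,2)$-DDP. **Disjoint concordances property.** A path concordance in $X$ is a map $F:D\times I\to X\times I$ with $F(D\times\{e\})\subset X\times\{e\}$ for $e=0,1$. $X$ has the disjoint concordances property if for any maps $f_1,f_2:D\times I\to X$ and any $\varepsilon>0$ there are path concordances $F_1,F_2$ in $X$ with disjoint images such that $\rho(f_i,\operatorname{proj}_X F_i)<\varepsilon$ for $i=1,2$. **DTP\*.** A topographical map pair on a space $W$ is a pair of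 maps $f:W\to X$, $\tau:W\to I$. Pairs $(f_1,\tau_1)$ and $(f_2,\tau_2)$ are *disjoint* if $f_1(\tau_1^{-1}(t))\cap f_2(\tau_2^{-1}(t))=\emptyset$ for all $t\in I$. For a space $Z$, the category of $Z$ consists of the pairs $(f,\tau)$ on $Z\times I$ with $\tau(z,0)=0$ and $\tau(z,1)=1$ for all $z\in Z$; such a pair is in the constant category of $Z$ if moreover $f(z,t)$ does not depend on $t$ and $\tau(z,t)=t$. The category $\mathcal{D}$ (resp. $\mathcal{D}_c$) is the category (resp. constant category) of $Z=D$, and $\mathcal{K}$ (resp. $\mathcal{K}_c$) consists of the categories (resp. constant categories) of all 1-complexes $Z=K$. $X$ has the * $\mathcal{D}\times\mathcal{D}$ DTP\* if for all $(f_1,\tau_1),(f_2,\tau_2)\in\mathcal{D}$ and every $\varepsilon>0$ there are disjoint topographical map pairs $(f_1',\tau_1'),(f_2',\tau_2')\in\mathcal{D}$ with $\rho(f_i',f_i)<\varepsilon$ for $i=1,2$; * $\mathcal{D}_c\times\mathcal{D}$ DTP\* if the same holds for all $(f_1,\tau_1)\in\mathcal{D}_c$ and $(f_2,\tau_2)\in\mathcal{D}$,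 the approximating pairs again being required only to lie in $\mathcal{D}$; * $\mathcal{K}_c\times\mathcal{K}$ DTP\* if for all 1-complexes $K_1,K_2$, all $(f_1,\tau_1)$ in the constant category of $K_1$, all $(f_2,\tau_2)$ in the category of $K_2$ and every $\varepsilon>0$ there are disjoint topographical map pairs $(f_i',\tau_i')$ in the category of $K_i$ with $\rho(f_i',f_i)<\varepsilon$ for $i=1,2$. In each case $\tau_i'$ need not be close to $\tau_i$. **Equivalence Theorem.** Let $X$ be a locally compact separable metric space that is an ANR and has the DAP. Consider the statements: (a) $X$ has the $\mathcal{D}_c\times\mathcal{D}$ DTP\*; (b) $X$ has the $\mathcal{K}_c\times\mathcal{K}$ DTP\*; (c) $X$ has the $\mathcal{D}\times\mathcal{D}$ DTP\*; (d) $X$ has the disjoint concordances property; (e) $X\times\mathbb{R}$ has the DDP. Then (b), (c), (d), (e) are equivalent. If in addition $X$ has the $(0,2)$-DDP, then (a), (b), (c), (d), (e) are equivalent. -/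

import Mathlib

open scoped unitInterval

universe u v w

/-- `X` is an absolute neighbourhood retract (for metrizable spaces): `X` is metrizable and, whenever
`X` is embedded as a closed subset of a metrizable space `Y`, some open neighbourhood of the image
of `X` in `Y` retracts onto it. -/
def IsANR (X : Type u) [TopologicalSpace X] : Prop :=
  TopologicalSpace.MetrizableSpace X ∧
    ∀ (Y : Type u) [TopologicalSpace Y] [TopologicalSpace.MetrizableSpace Y] (e : X → Y),
      Topology.IsClosedEmbedding e →
        ∃ U : Set Y, IsOpen U ∧ ∃ hU : ∀ x, e x ∈ U, ∃ r : C(U, X), ∀ x, r ⟨e x, hU x⟩ = x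

/-- The standard closed `n`-dimensional disk `Dⁿ`. -/
abbrev Disk (n : ℕ) : Type := Metric.closedBall (0 : EuclideanSpace ℝ (Fin n)) 1

/-- The `(m, n)`-disjoint disks property: any two maps `Dᵐ → X` and `Dⁿ → X` can be approximated
arbitrarily closely by maps with disjoint images. -/
def HasDisjointDisks (m n : ℕ) (X : Type u) [MetricSpace X] : Prop :=
  ∀ (f : C(Disk m, X)) (g : C(Disk n, X)) (ε : ℝ), 0 < ε →
    ∃ (f' : C(Disk m, X)) (g' : C(Disk n, X)),
      (∀ x, dist (f' x) (f x) < ε) ∧ (∀ y, dist (g' y) (g y) < ε) ∧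
        Disjoint (Set.range f') (Set.range g')

/-- The disjoint arcs property (DAP). -/
def HasDAP (X : Type u) [MetricSpace X] : Prop := HasDisjointDisks 1 1 X

/-- The disjoint disks property (DDP). -/
def HasDDP (X : Type u) [MetricSpace X] : Prop := HasDisjointDisks 2 2 X

/-- A path concordance in `X`: a map `F : D × I → X × I`, `D = I = [0,1]`, with
`F (D × {e}) ⊆ X × {e}` for `e = 0, 1`. -/
def IsPathConcordance {X : Type u} [TopologicalSpace X] (F : C(I × I, X × I)) : Prop :=
  ∀ x : I, (F (x, 0)).2 = 0 ∧ (F (x, 1)).2 = 1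

/-- The disjoint (path) concordances property. -/
def HasDisjointConcordances (X : Type u) [MetricSpace X] : Prop :=
  ∀ (f₁ f₂ : C(I × I, X)) (ε : ℝ), 0 < ε →
    ∃ F₁ F₂ : C(I × I, X × I), IsPathConcordance F₁ ∧ IsPathConcordance F₂ ∧
      Disjoint (Set.range F₁) (Set.range F₂) ∧
        (∀ z, dist (f₁ z) (F₁ z).1 < ε) ∧ (∀ z, dist (f₂ z) (F₂ z).1 < ε)

/-- A topographical map pair `(f, τ)`: a spatial map `f : Z → X` and a level map `τ : Z → I`. -/
structure TopographicalPair (Z : Type v) (X : Type u) [TopologicalSpace Z] [TopologicalSpace X] where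
  spatial : C(Z, X)
  level : C(Z, I)

namespace TopographicalPair

/-- Disjoint topographical map pairs: `f₁ (τ₁⁻¹ t) ∩ f₂ (τ₂⁻¹ t) = ∅` for all `t ∈ I`. -/
def IsDisjoint {Z₁ : Type v} {Z₂ : Type w} {X : Type u} [TopologicalSpace Z₁]
    [TopologicalSpace Z₂] [TopologicalSpace X]
    (p₁ : TopographicalPair Z₁ X) (p₂ : TopographicalPair Z₂ X) : Prop :=
  ∀ t : I, Disjoint (p₁.spatial '' (p₁.level ⁻¹' {t})) (p₂.spatial '' (p₂.level ⁻¹' {t}))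

/-- `(f, τ)` belongs to the category of `Z`: `f` and `τ` are defined on `Z × I` and
`Z × {e} ⊆ τ⁻¹ e` for `e = 0, 1`. -/
def InCategory {Z : Type v} {X : Type u} [TopologicalSpace Z] [TopologicalSpace X]
    (p : TopographicalPair (Z × I) X) : Prop :=
  ∀ z : Z, p.level (z, 0) = 0 ∧ p.level (z, 1) = 1

/-- `(f, τ)` belongs to the constant category of `Z`: it belongs to the category of `Z`, `f` is a
constant homotopy and `τ (z, t) = t`. -/
def InConstCategory {Z : Type v} {X : Type u} [TopologicalSpace Z] [TopologicalSpace X]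
    (p : TopographicalPair (Z × I) X) : Prop :=
  p.InCategory ∧ (∀ (z : Z) (s t : I), p.spatial (z, s) = p.spatial (z, t)) ∧
    ∀ (z : Z) (t : I), p.level (z, t) = t

end TopographicalPair

/-- The pairs `p₁` and `p₂`, defined on `Z₁ × I` and `Z₂ × I`, satisfy the conclusion of the
star version of the category disjoint topographies property: their spatial maps can be approximated
arbitrarily closely by the spatial maps of disjoint topographical map pairs in the categories of
`Z₁` and `Z₂`. The new level maps need not be close to the old ones, and the approximating pairs
need not be in the constant categories. -/
def StarSeparable {Z₁ : Type v} {Z₂ : Type w} {X : Type u} [TopologicalSpace Z₁]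
    [TopologicalSpace Z₂] [MetricSpace X]
    (p₁ : TopographicalPair (Z₁ × I) X) (p₂ : TopographicalPair (Z₂ × I) X) : Prop :=
  ∀ ε : ℝ, 0 < ε → ∃ (q₁ : TopographicalPair (Z₁ × I) X) (q₂ : TopographicalPair (Z₂ × I) X),
    q₁.InCategory ∧ q₂.InCategory ∧
      (∀ z, dist (q₁.spatial z) (p₁.spatial z) < ε) ∧
      (∀ z, dist (q₂.spatial z) (p₂.spatial z) < ε) ∧ q₁.IsDisjoint q₂

/-- A (finite simplicial) `1`-complex in a Euclidean space. -/
def IsOneComplex {n : ℕ} (K : Geometry.SimplicialComplex ℝ (EuclideanSpace ℝ (Fin n))) : Prop :=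
  K.faces.Finite ∧ ∀ s ∈ K.faces, s.card ≤ 2

/-- The `D × D` DTP*. -/
def HasDDStar (X : Type u) [MetricSpace X] : Prop :=
  ∀ p₁ p₂ : TopographicalPair (I × I) X, p₁.InCategory → p₂.InCategory → StarSeparable p₁ p₂

/-- The `D_c × D` DTP*. -/
def HasDcDStar (X : Type u) [MetricSpace X] : Prop :=
  ∀ p₁ p₂ : TopographicalPair (I × I) X, p₁.InConstCategory → p₂.InCategory → StarSeparable p₁ p₂

/-- The `K_c × K` DTP*. -/
def HasKcKStar (X : Type u) [MetricSpace X] : Prop :=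
  ∀ (m n : ℕ) (K₁ : Geometry.SimplicialComplex ℝ (EuclideanSpace ℝ (Fin m)))
    (K₂ : Geometry.SimplicialComplex ℝ (EuclideanSpace ℝ (Fin n))),
    IsOneComplex K₁ → IsOneComplex K₂ →
      ∀ (p₁ : TopographicalPair (K₁.space × I) X) (p₂ : TopographicalPair (K₂.space × I) X),
        p₁.InConstCategory → p₂.InCategory → StarSeparable p₁ p₂

/-! Since `X` is a locally compact separable ANR, a nonempty `X` embeds isometrically by `k` in a
normed space in which a neighbourhood of the image retracts onto it by `r`. A map `f` into `X` is
therefore perturbed by adding small vectors to `k ∘ f`, damped by Urysohn functions, and applying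
`r`. In this way approximate disjointness of two arcs, or of two squares, becomes general position
for finitely many pairs of them (`exists_approx_forall_disjoint`).

(c) and (d) are the same statement, since a concordance is a topographical pair read as one map.
Both (b) and (c) imply (a): (c) by specialization, (b) because an arc is a retract of a 1-complex.
It remains to prove (e) ⇒ (b), (e) ⇒ (c) and (a) ⇒ (e).

From (e) (`IsNbhdRetraction.starSeparable`): the DAP makes the ends at times 0 and 1 disjoint, and
the DDP of `X × ℝ` makes the graphs of the homotopies disjoint. The second motion is damped to zero
at the ends, where distance in `X` keeps the maps apart.

From (a) to (e) (`approxDisjoint_prod_real`): two squares in `X × ℝ` are replaced by staircases,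
which are horizontal over each cell of a fine grid and change level only on walls over the grid. All
cell levels are distinct, and the cells inside one cell of a coarser grid have nearly the same
level; hence a wall of one staircase that reaches a cell level of the other lies over the coarse
grid. The DAP makes the images of the two grids disjoint and the coarse grids almost embedded, so a
cell meets the opposite coarse grid only within the star of one vertex, which is a cross. The task
is thus to push a square, relative to its boundary, off a cross times a short level interval
(`exists_cross_displacement`). A cross is not an arc, but its identity is homotopic, relative to the
tips, to a map that factors through an arc. The wall runs through this homotopy, then follows the
arc homotopy that (a) makes disjoint from the square, and then returns. The pushes for different
cells live in disjoint level intervals and do not interfere. -/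

open Topology Filter

/-! ### Neighbourhood retractions in a normed space -/

/-- `r` is a retraction of a neighbourhood of `k(Y)` in a normed space onto the isometrically
embedded space `Y`. -/
structure IsNbhdRetraction {Y : Type u} [MetricSpace Y] {E : Type v} [NormedAddCommGroup E]
    [NormedSpace ℝ E] (k : Y → E) (r : E → Y) : Prop where
  isometry : Isometry k
  leftInv : ∀ y, r (k y) = y
  eventually_continuousAt : ∀ y, ∀ᶠ e in 𝓝 (k y), ContinuousAt r e

namespace IsNbhdRetraction

variable {Y : Type u} [MetricSpace Y] {E : Type v} [NormedAddCommGroup E] [NormedSpace ℝ E]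
  {k : Y → E} {r : E → Y}

theorem norm_sub (H : IsNbhdRetraction k r) (x y : Y) : ‖k x - k y‖ = dist x y := by
  rw [← dist_eq_norm, H.isometry.dist_eq]

theorem continuous_left (H : IsNbhdRetraction k r) : Continuous k := H.isometry.continuous

/-- A Lebesgue number for the compact image of `k ∘ F` makes the pointwise continuity of `r` near
`k(Y)` uniform. -/
theorem exists_delta (H : IsNbhdRetraction k r) {Z : Type w} [TopologicalSpace Z] [CompactSpace Z]
    (F : C(Z, Y)) {ε : ℝ} (hε : 0 < ε) :
    ∃ δ > 0, ∀ z e, ‖e - k (F z)‖ < δ → ContinuousAt r e ∧ dist (r e) (F z) < ε := by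
  have h1 : ∀ y : Y, ∃ δ > 0, ∀ e ∈ Metric.ball (k y) δ,
      ContinuousAt r e ∧ dist (r e) y < ε / 2 := by
    intro y
    have hc : ContinuousAt r (k y) := (H.eventually_continuousAt y).self_of_nhds
    have h2 : ∀ᶠ e in 𝓝 (k y), dist (r e) y < ε / 2 := by
      have := hc.eventually (Metric.ball_mem_nhds (r (k y)) (half_pos hε))
      simpa [H.leftInv] using this
    exact Metric.eventually_nhds_iff_ball.1 ((H.eventually_continuousAt y).and h2)
  choose d hd hb using h1
  have hK : IsCompact (Set.range fun z => k (F z)) :=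
    isCompact_range (H.continuous_left.comp F.continuous)
  obtain ⟨δ, hδ, hcov⟩ := lebesgue_number_lemma_of_metric (c := fun y : Y => Metric.ball (k y) (d y))
    hK (fun _ => Metric.isOpen_ball) (by
      rintro _ ⟨z, rfl⟩
      exact Set.mem_iUnion.2 ⟨F z, Metric.mem_ball_self (hd _)⟩)
  refine ⟨δ, hδ, fun z e he => ?_⟩
  obtain ⟨y, hy⟩ := hcov _ ⟨z, rfl⟩
  have he' := hb y e (hy (by rwa [Metric.mem_ball, dist_eq_norm]))
  have hz' := hb y _ (hy (Metric.mem_ball_self hδ))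
  rw [H.leftInv] at hz'
  refine ⟨he'.1, ?_⟩
  calc dist (r e) (F z) ≤ dist (r e) y + dist (F z) y := dist_triangle_right _ _ _
    _ < ε := by linarith [he'.2, hz'.2]

/-- The basic perturbation device. The formula for `F'` is part of the conclusion because, wherever
`g` has the form `k ∘ f'`, it gives `F' = f'` exactly, so disjointness obtained for `f'` carries
over. -/
theorem exists_delta_map (H : IsNbhdRetraction k r) {Z : Type w} [TopologicalSpace Z]
    [CompactSpace Z] (F : C(Z, Y)) {ε : ℝ} (hε : 0 < ε) :
    ∃ δ > 0, ∀ g : Z → E, Continuous g → (∀ z, ‖g z - k (F z)‖ < δ) →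
      ∃ F' : C(Z, Y), (∀ z, F' z = r (g z)) ∧ ∀ z, dist (F' z) (F z) < ε := by
  obtain ⟨δ, hδ, h⟩ := H.exists_delta F hε
  refine ⟨δ, hδ, fun g hg hgF => ⟨⟨fun z => r (g z), ?_⟩, fun _ => rfl, fun z => (h z _ (hgF z)).2⟩⟩
  exact continuous_iff_continuousAt.2 fun z =>
    (h z _ (hgF z)).1.comp hg.continuousAt

theorem prodReal (H : IsNbhdRetraction k r) :
    IsNbhdRetraction (fun p : Y × ℝ => (k p.1, p.2)) (fun p : E × ℝ => (r p.1, p.2)) where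
  isometry := H.isometry.prodMap isometry_id
  leftInv p := by simp [H.leftInv]
  eventually_continuousAt p := by
    have h : ∀ᶠ e : E × ℝ in 𝓝 (k p.1, p.2), ContinuousAt r e.1 :=
      continuous_fst.continuousAt.eventually (H.eventually_continuousAt p.1)
    filter_upwards [h] with e he
    exact (ContinuousAt.comp he continuous_fst.continuousAt).prodMk continuous_snd.continuousAt

end IsNbhdRetraction

/-- A locally compact space is closed in some open neighbourhood of its isometric image. -/
theorem Isometry.exists_isOpen_inter_closure_subset_range {X : Type u} [MetricSpace X]
    [LocallyCompactSpace X] {E : Type v} [MetricSpace E] {k : X → E} (hk : Isometry k) :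
    ∃ V : Set E, IsOpen V ∧ Set.range k ⊆ V ∧ V ∩ closure (Set.range k) ⊆ Set.range k := by
  have h1 : ∀ x : X, ∃ ρ > 0, IsCompact (Metric.closedBall x ρ) := fun x => by
    obtain ⟨K, hK, hx⟩ := exists_compact_mem_nhds x
    obtain ⟨ρ, hρ, hsub⟩ := Metric.nhds_basis_closedBall.mem_iff.1 hx
    exact ⟨ρ, hρ, hK.of_isClosed_subset Metric.isClosed_closedBall hsub⟩
  choose ρ hρ hc using h1
  refine ⟨⋃ x, Metric.ball (k x) (ρ x), isOpen_iUnion fun _ => Metric.isOpen_ball, ?_, ?_⟩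
  · rintro _ ⟨x, rfl⟩
    exact Set.mem_iUnion.2 ⟨x, Metric.mem_ball_self (hρ x)⟩
  · rintro e ⟨heV, hecl⟩
    obtain ⟨x, hx⟩ := Set.mem_iUnion.1 heV
    have h2 : e ∈ closure (Metric.ball (k x) (ρ x) ∩ Set.range k) :=
      Metric.isOpen_ball.inter_closure ⟨hx, hecl⟩
    have h3 : Metric.ball (k x) (ρ x) ∩ Set.range k ⊆ k '' Metric.closedBall x (ρ x) := by
      rintro _ ⟨hb, y, rfl⟩
      rw [Metric.mem_ball, hk.dist_eq] at hb
      exact ⟨y, hb.le, rfl⟩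
    have h4 := closure_minimal h3 ((hc x).image hk.continuous).isClosed h2
    exact Set.image_subset_range _ _ h4

/-- By local compactness the image is closed in an open set `V`, though perhaps not in `E`, so the
ANR property is applied to `V`, lifted to the universe of `X`. The values of `r` off the
neighbourhood are irrelevant. -/
theorem IsANR.exists_isNbhdRetraction_of_isometry {X : Type u} [MetricSpace X]
    [LocallyCompactSpace X] [Nonempty X] (h : IsANR X) {E : Type} [NormedAddCommGroup E]
    [NormedSpace ℝ E] {k : X → E} (hk : Isometry k) : ∃ r : E → X, IsNbhdRetraction k r := by
  classical
  obtain ⟨V, hV, hkV, hcl⟩ := hk.exists_isOpen_inter_closure_subset_range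
  let Y := ULift.{u} V
  let j : Y → E := fun y => (y.down : E)
  have hj : IsOpenEmbedding j :=
    hV.isOpenEmbedding_subtypeVal.comp Homeomorph.ulift.isOpenEmbedding
  let e : X → Y := fun x => ⟨⟨k x, hkV ⟨x, rfl⟩⟩⟩
  have hje : ∀ x, j (e x) = k x := fun x => rfl
  have hemb : IsEmbedding e := by
    refine IsEmbedding.of_comp ?_ hj.continuous ?_
    · exact hj.isInducing.continuous_iff.2 hk.continuous
    · exact hk.isEmbedding
  have hrange : Set.range e = j ⁻¹' closure (Set.range k) := by
    ext y
    constructor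
    · rintro ⟨x, rfl⟩
      exact subset_closure ⟨x, rfl⟩
    · intro hy
      obtain ⟨x, hx⟩ := hcl ⟨y.down.2, hy⟩
      exact ⟨x, hj.injective hx⟩
  have : TopologicalSpace.MetrizableSpace Y := hj.isEmbedding.metrizableSpace
  obtain ⟨U, hU, heU, r, hr⟩ := h.2 Y e
    ⟨hemb, hrange ▸ isClosed_closure.preimage hj.continuous⟩
  let r' : E → X := fun z => if hz : ∃ y : U, j y = z then r hz.choose else Classical.arbitrary X
  have hr' : ∀ y : U, r' (j y) = r y := fun y => by
    have hz : ∃ y' : U, j y' = j y := ⟨y, rfl⟩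
    have : hz.choose = y := Subtype.ext (hj.injective hz.choose_spec)
    simp only [r', dif_pos hz, this]
  refine ⟨r', hk, fun x => ?_, fun x => ?_⟩
  · rw [← hje x, hr' ⟨e x, heU x⟩, hr]
  · have hW : j '' U ∈ 𝓝 (k x) := (hj.isOpenMap U hU).mem_nhds ⟨e x, heU x, rfl⟩
    filter_upwards [hW]
    rintro _ ⟨y, hy, rfl⟩
    rw [← hj.continuousAt_iff]
    have hon : ContinuousOn (r' ∘ j) U := by
      rw [continuousOn_iff_continuous_domRestrict]
      convert r.continuous using 1
      funext z
      exact hr' z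
    exact hon.continuousAt (hU.mem_nhds hy)

theorem IsANR.exists_isNbhdRetraction {X : Type u} [MetricSpace X] [LocallyCompactSpace X]
    [TopologicalSpace.SeparableSpace X] [Nonempty X] (h : IsANR X) :
    ∃ (E : Type) (_ : NormedAddCommGroup E) (_ : NormedSpace ℝ E) (k : X → E) (r : E → X),
      IsNbhdRetraction k r := by
  obtain ⟨r, hr⟩ := h.exists_isNbhdRetraction_of_isometry (kuratowskiEmbedding.isometry X)
  exact ⟨_, _, _, _, r, hr⟩

/-! ### General position -/

/-- Any two maps `W → Y`, `W' → Y` can be approximated by maps with disjoint images. -/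
def ApproxDisjoint (Y : Type u) [MetricSpace Y] (W : Type v) [TopologicalSpace W] (W' : Type w)
    [TopologicalSpace W'] : Prop :=
  ∀ (f : C(W, Y)) (g : C(W', Y)) (ε : ℝ), 0 < ε →
    ∃ (f' : C(W, Y)) (g' : C(W', Y)),
      (∀ x, dist (f' x) (f x) < ε) ∧ (∀ y, dist (g' y) (g y) < ε) ∧
        Disjoint (Set.range f') (Set.range g')

theorem ApproxDisjoint.of_retract {Y : Type u} [MetricSpace Y] {W : Type v} [TopologicalSpace W]
    {W' : Type w} [TopologicalSpace W'] (h : ApproxDisjoint Y W W) (i : C(W', W)) (p : C(W, W'))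
    (hpi : ∀ x, p (i x) = x) : ApproxDisjoint Y W' W' := by
  intro f g ε hε
  obtain ⟨f', g', hf, hg, hd⟩ := h (f.comp p) (g.comp p) ε hε
  refine ⟨f'.comp i, g'.comp i, fun x => ?_, fun x => ?_, ?_⟩
  · simpa [hpi] using hf (i x)
  · simpa [hpi] using hg (i x)
  · refine hd.mono ?_ ?_ <;> rintro _ ⟨x, rfl⟩ <;> exact ⟨i x, rfl⟩

theorem IsCompact.exists_pos_le_dist {Y : Type u} [MetricSpace Y] {S T : Set Y} (hS : IsCompact S)
    (hT : IsCompact T) (h : Disjoint S T) : ∃ η > 0, ∀ x ∈ S, ∀ y ∈ T, η ≤ dist x y := by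
  obtain ⟨η, hη, hle⟩ := (hS.prod hT).exists_forall_le' (f := fun p : Y × Y => dist p.1 p.2)
    (by fun_prop) (a := 0) (by
      rintro ⟨x, y⟩ ⟨hx, hy⟩
      exact dist_pos.2 (h.ne_of_mem hx hy))
  exact ⟨η, hη, fun x hx y hy => hle (x, y) ⟨hx, hy⟩⟩

namespace IsNbhdRetraction

variable {Y : Type u} [MetricSpace Y] {E : Type v} [NormedAddCommGroup E] [NormedSpace ℝ E]
  {k : Y → E} {r : E → Y}

/-- The displacements that separate `F ∘ φ₁` from `F ∘ φ₂` are extended to `Z` through the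
retractions `φᵢ ∘ ψᵢ` and blended by a Urysohn function `μ` for the disjoint ranges. The form `φ ψ φ
= φ` admits degenerate arcs. -/
theorem exists_approx_disjoint_pair (H : IsNbhdRetraction k r) {W : Type*} [TopologicalSpace W]
    [CompactSpace W] (hW : ApproxDisjoint Y W W) {Z : Type*} [TopologicalSpace Z] [CompactSpace Z]
    [T2Space Z] {φ₁ φ₂ : C(W, Z)} {ψ₁ ψ₂ : C(Z, W)} (h₁ : ∀ w, φ₁ (ψ₁ (φ₁ w)) = φ₁ w)
    (h₂ : ∀ w, φ₂ (ψ₂ (φ₂ w)) = φ₂ w) (hd : Disjoint (Set.range φ₁) (Set.range φ₂)) (F : C(Z, Y))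
    {ε : ℝ} (hε : 0 < ε) :
    ∃ F' : C(Z, Y), (∀ z, dist (F' z) (F z) < ε) ∧
      Disjoint (Set.range fun w => F' (φ₁ w)) (Set.range fun w => F' (φ₂ w)) := by
  obtain ⟨δ, hδ, hF⟩ := H.exists_delta_map F hε
  obtain ⟨f, g, hf, hg, hfg⟩ := hW (F.comp φ₁) (F.comp φ₂) (δ / 2) (half_pos hδ)
  obtain ⟨μ, hμ₂, hμ₁, hμ⟩ := exists_continuous_zero_one_of_isClosed
    (isCompact_range φ₂.continuous).isClosed (isCompact_range φ₁.continuous).isClosed hd.symm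
  have hk := H.continuous_left
  let G : Z → E := fun z => k (F z) + (μ z • (k (f (ψ₁ z)) - k (F (φ₁ (ψ₁ z)))) +
    (1 - μ z) • (k (g (ψ₂ z)) - k (F (φ₂ (ψ₂ z)))))
  obtain ⟨F', hF', hF'F⟩ := hF G (by fun_prop) (fun z => by
    have e1 : ‖k (f (ψ₁ z)) - k (F (φ₁ (ψ₁ z)))‖ < δ / 2 := by rw [H.norm_sub]; exact hf _
    have e2 : ‖k (g (ψ₂ z)) - k (F (φ₂ (ψ₂ z)))‖ < δ / 2 := by rw [H.norm_sub]; exact hg _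
    have hμz := hμ z
    simp only [G, add_sub_cancel_left]
    refine (norm_add_le _ _).trans_lt ?_
    rw [norm_smul, norm_smul, Real.norm_of_nonneg hμz.1, Real.norm_of_nonneg (by linarith [hμz.2])]
    have a1 := mul_le_of_le_one_left (norm_nonneg (k (f (ψ₁ z)) - k (F (φ₁ (ψ₁ z))))) hμz.2
    have a2 := mul_le_of_le_one_left (norm_nonneg (k (g (ψ₂ z)) - k (F (φ₂ (ψ₂ z)))))
      (show 1 - μ z ≤ 1 by linarith [hμz.1])
    linarith)
  refine ⟨F', hF'F, ?_⟩
  have e1 : ∀ w, F' (φ₁ w) = f (ψ₁ (φ₁ w)) := fun w => by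
    rw [hF', ← H.leftInv (f (ψ₁ (φ₁ w)))]
    simp [G, h₁, hμ₁ (Set.mem_range_self w)]
  have e2 : ∀ w, F' (φ₂ w) = g (ψ₂ (φ₂ w)) := fun w => by
    rw [hF', ← H.leftInv (g (ψ₂ (φ₂ w)))]
    simp [G, h₂, hμ₂ (Set.mem_range_self w)]
  refine hfg.mono ?_ ?_ <;> rintro _ ⟨w, rfl⟩
  · exact ⟨_, (e1 w).symm⟩
  · exact ⟨_, (e2 w).symm⟩

/-- General position: finitely many disjointness conditions on images of retracts of type `W` can
be achieved simultaneously by a small perturbation. -/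
theorem exists_approx_forall_disjoint (H : IsNbhdRetraction k r) {W : Type*} [TopologicalSpace W]
    [CompactSpace W] (hW : ApproxDisjoint Y W W) {Z : Type*} [TopologicalSpace Z] [CompactSpace Z]
    [T2Space Z] {ι : Type*} (φ : ι → C(W, Z)) (ψ : ι → C(Z, W))
    (h : ∀ i w, φ i (ψ i (φ i w)) = φ i w) (R : Finset (ι × ι))
    (hR : ∀ p ∈ R, Disjoint (Set.range (φ p.1)) (Set.range (φ p.2))) (F : C(Z, Y))
    {ε : ℝ} (hε : 0 < ε) :
    ∃ F' : C(Z, Y), (∀ z, dist (F' z) (F z) < ε) ∧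
      ∀ p ∈ R, ∀ w w', F' (φ p.1 w) ≠ F' (φ p.2 w') := by
  classical
  induction R using Finset.induction_on generalizing ε with
  | empty => exact ⟨F, fun z => by simpa using hε, by simp⟩
  | insert p R hp ih =>
    obtain ⟨F₁, hF₁, hd₁⟩ := ih (fun q hq => hR q (Finset.mem_insert_of_mem hq)) (half_pos hε)
    have hη : ∃ η > 0, ∀ q ∈ R, ∀ w w', η ≤ dist (F₁ (φ q.1 w)) (F₁ (φ q.2 w')) := by
      have : ∀ q : ι × ι, ∃ η > 0, q ∈ R → ∀ w w', η ≤ dist (F₁ (φ q.1 w)) (F₁ (φ q.2 w')) := by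
        intro q
        by_cases hq : q ∈ R
        · obtain ⟨η, hη, hle⟩ := (isCompact_range (F₁.comp (φ q.1)).continuous).exists_pos_le_dist
            (isCompact_range (F₁.comp (φ q.2)).continuous) (by
              rw [Set.disjoint_left]
              rintro _ ⟨w, rfl⟩ ⟨w', h'⟩
              exact hd₁ q hq w w' h'.symm)
          exact ⟨η, hη, fun _ w w' => hle _ ⟨w, rfl⟩ _ ⟨w', rfl⟩⟩
        · exact ⟨1, one_pos, fun h => (hq h).elim⟩
      choose η hη hle using this
      rcases R.eq_empty_or_nonempty with rfl | hne
      · exact ⟨1, one_pos, by simp⟩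
      · obtain ⟨q, hq, hmin⟩ := R.exists_min_image η hne
        exact ⟨η q, hη q, fun q' hq' w w' => (hmin q' hq').trans (hle q' hq' w w')⟩
    obtain ⟨η, hη, hle⟩ := hη
    -- A move by less than half of the gap `η` cannot destroy the disjointness already achieved.
    obtain ⟨F₂, hF₂, hd₂⟩ := H.exists_approx_disjoint_pair hW (h p.1) (h p.2)
      (hR p (Finset.mem_insert_self _ _)) F₁ (lt_min (half_pos hε) (half_pos hη))
    refine ⟨F₂, fun z => ?_, fun q hq w w' => ?_⟩
    · have := (hF₂ z).trans_le (min_le_left _ _)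
      linarith [dist_triangle (F₂ z) (F₁ z) (F z), hF₁ z]
    · rcases Finset.mem_insert.1 hq with rfl | hq
      · exact hd₂.ne_of_mem ⟨w, rfl⟩ ⟨w', rfl⟩
      · intro heq
        have a1 := (hF₂ (φ q.1 w)).trans_le (min_le_right _ _)
        have a2 := (hF₂ (φ q.2 w')).trans_le (min_le_right _ _)
        rw [← heq] at a2
        linarith [hle q hq w w', dist_triangle_left (F₁ (φ q.1 w)) (F₁ (φ q.2 w')) (F₂ (φ q.1 w))]

end IsNbhdRetraction

/-! ### Disks replaced by intervals and squares -/

/-- Truncation of a real number to the unit interval. -/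
noncomputable def unitClamp (x : ℝ) : I := Set.projIcc 0 1 zero_le_one x

@[fun_prop]
theorem continuous_unitClamp : Continuous unitClamp :=
  continuous_projIcc (h := zero_le_one)

theorem unitClamp_coe (x : I) : unitClamp x = x := Set.projIcc_val _ x

theorem coe_unitClamp (x : ℝ) : (unitClamp x : ℝ) = max 0 (min 1 x) := by
  simp [unitClamp, Set.coe_projIcc]

theorem HasDisjointDisks.approxDisjoint_unitInterval {X : Type u} [MetricSpace X]
    (h : HasDisjointDisks 1 1 X) : ApproxDisjoint X I I := by
  refine ApproxDisjoint.of_retract (W := Disk 1) h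
    ⟨fun x => ⟨!₂[(x : ℝ)], ?_⟩, ?_⟩ ⟨fun z => unitClamp (z.1 0), by fun_prop⟩ fun x => ?_
  · simp [EuclideanSpace.norm_eq, abs_of_nonneg x.2.1, x.2.2]
  · fun_prop
  · simp [unitClamp_coe]

theorem HasDisjointDisks.approxDisjoint_square {X : Type u} [MetricSpace X]
    (h : HasDisjointDisks 2 2 X) : ApproxDisjoint X (I × I) (I × I) := by
  refine ApproxDisjoint.of_retract (W := Disk 2) h
    -- Halving places the unit square inside the unit disk, of which it is a retract by clamping
    -- coordinates.
    ⟨fun x => ⟨!₂[(x.1 : ℝ) / 2, (x.2 : ℝ) / 2], ?_⟩, ?_⟩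
    ⟨fun z => (unitClamp (2 * z.1 0), unitClamp (2 * z.1 1)), by fun_prop⟩ fun x => ?_
  · have h1 := x.1.2
    have h2 := x.2.2
    simp only [mem_closedBall_zero_iff, EuclideanSpace.norm_eq, Fin.sum_univ_two]
    rw [Real.sqrt_le_left zero_le_one]
    simp only [Real.norm_eq_abs, sq_abs]
    simp
    nlinarith [h1.1, h1.2, h2.1, h2.2]
  · fun_prop
  · have e (y : I) : (2 : ℝ) * ((y : ℝ) / 2) = y := by ring
    simp [e, unitClamp_coe]

/-- The disk lies in the square of side 2 around the origin, and the radial map `x ↦ x / max 1 ‖x‖`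
retracts that square onto it. -/
theorem HasDisjointDisks.of_approxDisjoint_square {X : Type u} [MetricSpace X]
    (h : ApproxDisjoint X (I × I) (I × I)) : HasDisjointDisks 2 2 X := by
  let c : I × I → EuclideanSpace ℝ (Fin 2) := fun x => !₂[2 * (x.1 : ℝ) - 1, 2 * (x.2 : ℝ) - 1]
  have hc : Continuous c := by fun_prop
  refine ApproxDisjoint.of_retract (W' := Disk 2) h
    ⟨fun z => (unitClamp ((z.1 0 + 1) / 2), unitClamp ((z.1 1 + 1) / 2)), by fun_prop⟩
    ⟨fun x => ⟨(max 1 ‖c x‖)⁻¹ • c x, ?_⟩, ?_⟩ fun z => ?_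
  · rw [mem_closedBall_zero_iff, norm_smul, norm_inv, Real.norm_of_nonneg (by positivity),
      inv_mul_le_iff₀ (by positivity), mul_one]
    exact le_max_right _ _
  · refine Continuous.subtype_mk (Continuous.smul (Continuous.inv₀ (continuous_const.max hc.norm) fun x => ?_) hc) _
    positivity
  · have hz : ‖z.1‖ ≤ 1 := mem_closedBall_zero_iff.1 z.2
    have hi : ∀ i, (unitClamp ((z.1 i + 1) / 2) : ℝ) = (z.1 i + 1) / 2 := fun i => by
      have h1 := (PiLp.norm_apply_le z.1 i).trans hz
      rw [Real.norm_eq_abs, abs_le] at h1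
      rw [coe_unitClamp, min_eq_right (by linarith), max_eq_right (by linarith)]
    have hcz : c (unitClamp ((z.1 0 + 1) / 2), unitClamp ((z.1 1 + 1) / 2)) = z.1 := by
      ext i
      fin_cases i <;> simp [c, hi] <;> ring
    apply Subtype.ext
    simp [hcz, max_eq_left hz]

/-! ### From the DDP of `X × ℝ` to disjoint topographies -/

/-- `Z` is covered by finitely many (possibly degenerate) arcs, each of them a retract of `Z`. -/
def ArcCovered (Z : Type w) [TopologicalSpace Z] : Prop :=
  ∃ (ι : Type) (_ : Fintype ι) (φ : ι → C(I, Z)) (ψ : ι → C(Z, I)),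
    (∀ i u, φ i (ψ i (φ i u)) = φ i u) ∧ ∀ z, ∃ i u, φ i u = z

theorem arcCovered_unitInterval : ArcCovered I :=
  ⟨Unit, inferInstance, fun _ => ContinuousMap.id I, fun _ => ContinuousMap.id I, fun _ _ => rfl,
    fun z => ⟨(), z, rfl⟩⟩

namespace IsNbhdRetraction

variable {Y : Type u} [MetricSpace Y] {E : Type v} [NormedAddCommGroup E] [NormedSpace ℝ E]
  {k : Y → E} {r : E → Y}

/-- Two maps are one map on the disjoint union, where ranges in different summands are automatically
disjoint. The point `w₀` is the value of each retraction on the summand that it does not concern. -/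
theorem exists_approx_forall_disjoint₂ (H : IsNbhdRetraction k r) {W : Type*} [TopologicalSpace W]
    [CompactSpace W] [Nonempty W] (hW : ApproxDisjoint Y W W) {Z₁ Z₂ : Type*} [TopologicalSpace Z₁]
    [CompactSpace Z₁] [T2Space Z₁] [TopologicalSpace Z₂] [CompactSpace Z₂] [T2Space Z₂]
    {ι₁ ι₂ : Type*} (φ₁ : ι₁ → C(W, Z₁)) (ψ₁ : ι₁ → C(Z₁, W)) (φ₂ : ι₂ → C(W, Z₂))
    (ψ₂ : ι₂ → C(Z₂, W)) (h₁ : ∀ i w, φ₁ i (ψ₁ i (φ₁ i w)) = φ₁ i w)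
    (h₂ : ∀ i w, φ₂ i (ψ₂ i (φ₂ i w)) = φ₂ i w) (R : Finset (ι₁ × ι₂)) (F₁ : C(Z₁, Y))
    (F₂ : C(Z₂, Y)) {ε : ℝ} (hε : 0 < ε) :
    ∃ (F₁' : C(Z₁, Y)) (F₂' : C(Z₂, Y)), (∀ z, dist (F₁' z) (F₁ z) < ε) ∧
      (∀ z, dist (F₂' z) (F₂ z) < ε) ∧
      ∀ p ∈ R, ∀ w w', F₁' (φ₁ p.1 w) ≠ F₂' (φ₂ p.2 w') := by
  classical
  let w₀ : W := Classical.arbitrary W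
  let φ : ι₁ ⊕ ι₂ → C(W, Z₁ ⊕ Z₂) := Sum.elim
    (fun i => ⟨fun w => Sum.inl (φ₁ i w), by fun_prop⟩)
    (fun i => ⟨fun w => Sum.inr (φ₂ i w), by fun_prop⟩)
  let ψ : ι₁ ⊕ ι₂ → C(Z₁ ⊕ Z₂, W) := Sum.elim
    (fun i => ⟨Sum.elim (ψ₁ i) (fun _ => w₀), by fun_prop⟩)
    (fun i => ⟨Sum.elim (fun _ => w₀) (ψ₂ i), by fun_prop⟩)
  obtain ⟨F', hF', hd⟩ := H.exists_approx_forall_disjoint hW φ ψ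
    (by rintro (i | i) w <;> simp [φ, ψ, h₁, h₂])
    (R.image fun p => (Sum.inl p.1, Sum.inr p.2))
    (by
      intro q hq
      obtain ⟨p, -, rfl⟩ := Finset.mem_image.1 hq
      rw [Set.disjoint_left]
      rintro _ ⟨w, rfl⟩ ⟨w', h'⟩
      simp [φ] at h')
    (⟨Sum.elim F₁ F₂, by fun_prop⟩ : C(Z₁ ⊕ Z₂, Y)) hε
  refine ⟨⟨fun z => F' (Sum.inl z), by fun_prop⟩, ⟨fun z => F' (Sum.inr z), by fun_prop⟩,
    fun z => hF' (Sum.inl z), fun z => hF' (Sum.inr z), fun p hp w w' => ?_⟩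
  exact hd (Sum.inl p.1, Sum.inr p.2) (Finset.mem_image_of_mem _ hp) w w'

theorem exists_approx_ends_disjoint (H : IsNbhdRetraction k r) (hI : ApproxDisjoint Y I I)
    {Z₁ Z₂ : Type*} [TopologicalSpace Z₁] [CompactSpace Z₁] [T2Space Z₁] [TopologicalSpace Z₂]
    [CompactSpace Z₂] [T2Space Z₂] (hZ₁ : ArcCovered Z₁) (hZ₂ : ArcCovered Z₂)
    (f₁ : C(Z₁ × I, Y)) (f₂ : C(Z₂ × I, Y)) {ε : ℝ} (hε : 0 < ε) :
    ∃ (f₁' : C(Z₁ × I, Y)) (f₂' : C(Z₂ × I, Y)), (∀ z, dist (f₁' z) (f₁ z) < ε) ∧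
      (∀ z, dist (f₂' z) (f₂ z) < ε) ∧ ∀ z w, f₁' (z, 0) ≠ f₂' (w, 0) ∧ f₁' (z, 1) ≠ f₂' (w, 1) := by
  classical
  obtain ⟨ι₁, _, φ₁, ψ₁, h₁, hc₁⟩ := hZ₁
  obtain ⟨ι₂, _, φ₂, ψ₂, h₂, hc₂⟩ := hZ₂
  let e : Bool → I := fun b => if b then 1 else 0
  obtain ⟨F₁, F₂, hF₁, hF₂, hd⟩ := H.exists_approx_forall_disjoint₂ hI
    (fun i : ι₁ × Bool => ⟨fun u => (φ₁ i.1 u, e i.2), by fun_prop⟩)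
    (fun i : ι₁ × Bool => ⟨fun z => ψ₁ i.1 z.1, by fun_prop⟩)
    (fun i : ι₂ × Bool => ⟨fun u => (φ₂ i.1 u, e i.2), by fun_prop⟩)
    (fun i : ι₂ × Bool => ⟨fun z => ψ₂ i.1 z.1, by fun_prop⟩)
    (fun i u => by simp [h₁]) (fun i u => by simp [h₂]) Finset.univ f₁ f₂ hε
  refine ⟨F₁, F₂, hF₁, hF₂, fun z w => ?_⟩
  obtain ⟨i, u, rfl⟩ := hc₁ z
  obtain ⟨j, u', rfl⟩ := hc₂ w
  exact ⟨hd ((i, false), (j, false)) (Finset.mem_univ _) u u',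
    hd ((i, true), (j, true)) (Finset.mem_univ _) u u'⟩

theorem exists_approx_cylinders_disjoint (H : IsNbhdRetraction k r)
    (hS : ApproxDisjoint (Y × ℝ) (I × I) (I × I))
    {Z₁ Z₂ : Type*} [TopologicalSpace Z₁] [CompactSpace Z₁] [T2Space Z₁] [TopologicalSpace Z₂]
    [CompactSpace Z₂] [T2Space Z₂] (hZ₁ : ArcCovered Z₁) (hZ₂ : ArcCovered Z₂)
    (f₁ : C(Z₁ × I, Y × ℝ)) (f₂ : C(Z₂ × I, Y × ℝ)) {ε : ℝ} (hε : 0 < ε) :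
    ∃ (f₁' : C(Z₁ × I, Y × ℝ)) (f₂' : C(Z₂ × I, Y × ℝ)), (∀ z, dist (f₁' z) (f₁ z) < ε) ∧
      (∀ z, dist (f₂' z) (f₂ z) < ε) ∧ ∀ z w, f₁' z ≠ f₂' w := by
  obtain ⟨ι₁, _, φ₁, ψ₁, h₁, hc₁⟩ := hZ₁
  obtain ⟨ι₂, _, φ₂, ψ₂, h₂, hc₂⟩ := hZ₂
  obtain ⟨F₁, F₂, hF₁, hF₂, hd⟩ := H.prodReal.exists_approx_forall_disjoint₂ hS
    (fun i => (φ₁ i).prodMap (ContinuousMap.id I)) (fun i => (ψ₁ i).prodMap (ContinuousMap.id I))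
    (fun i => (φ₂ i).prodMap (ContinuousMap.id I)) (fun i => (ψ₂ i).prodMap (ContinuousMap.id I))
    (fun i u => by simp [Prod.map, h₁]) (fun i u => by simp [Prod.map, h₂]) Finset.univ f₁ f₂ hε
  refine ⟨F₁, F₂, hF₁, hF₂, ?_⟩
  rintro ⟨z, s⟩ ⟨w, t⟩
  obtain ⟨i, u, rfl⟩ := hc₁ z
  obtain ⟨j, u', rfl⟩ := hc₂ w
  exact hd (i, j) (Finset.mem_univ _) (u, s) (u', t)

end IsNbhdRetraction

/-- By compactness, the maximum of the distance and the two times (or the two times to 1) has a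
positive lower bound; if both times are below it, the distance is not. -/
theorem exists_pos_le_dist_of_ne_ends {Y : Type*} [MetricSpace Y] {Z₁ Z₂ : Type*}
    [TopologicalSpace Z₁] [CompactSpace Z₁] [TopologicalSpace Z₂] [CompactSpace Z₂]
    (f₁ : C(Z₁ × I, Y)) (f₂ : C(Z₂ × I, Y))
    (h : ∀ z w, f₁ (z, 0) ≠ f₂ (w, 0) ∧ f₁ (z, 1) ≠ f₂ (w, 1)) :
    ∃ η > 0, ∀ z w (s t : I), ((s : ℝ) < η ∧ (t : ℝ) < η ∨ 1 - (s : ℝ) < η ∧ 1 - (t : ℝ) < η) →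
      η ≤ dist (f₁ (z, s)) (f₂ (w, t)) := by
  obtain ⟨η, hη, hle⟩ := (isCompact_univ (X := (Z₁ × I) × (Z₂ × I))).exists_forall_le'
    (f := fun p => max (dist (f₁ p.1) (f₂ p.2)) (max (p.1.2 : ℝ) p.2.2))
    (by fun_prop) (a := 0) (by
      rintro ⟨⟨z, s⟩, ⟨w, t⟩⟩ -
      by_contra! hcon
      simp only [max_le_iff] at hcon
      obtain ⟨h0, h1, h2⟩ := hcon
      obtain rfl : s = 0 := Subtype.ext (le_antisymm h1 s.2.1)
      obtain rfl : t = 0 := Subtype.ext (le_antisymm h2 t.2.1)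
      exact (h z w).1 (dist_le_zero.1 h0))
  obtain ⟨η', hη', hle'⟩ := (isCompact_univ (X := (Z₁ × I) × (Z₂ × I))).exists_forall_le'
    (f := fun p => max (dist (f₁ p.1) (f₂ p.2)) (max (1 - (p.1.2 : ℝ)) (1 - (p.2.2 : ℝ))))
    (Continuous.continuousOn (by fun_prop)) (a := 0) (by
      rintro ⟨⟨z, s⟩, ⟨w, t⟩⟩ -
      by_contra! hcon
      simp only [max_le_iff, sub_nonpos] at hcon
      obtain ⟨h0, h1, h2⟩ := hcon
      obtain rfl : s = 1 := Subtype.ext (le_antisymm s.2.2 h1)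
      obtain rfl : t = 1 := Subtype.ext (le_antisymm t.2.2 h2)
      exact (h z w).2 (dist_le_zero.1 h0))
  refine ⟨min η η', lt_min hη hη', ?_⟩
  rintro z w s t (⟨hs, ht⟩ | ⟨hs, ht⟩)
  · rcases le_max_iff.1 (hle ((z, s), (w, t)) trivial) with h1 | h1
    · exact (min_le_left _ _).trans h1
    · exact absurd (h1.trans_lt (max_lt hs ht)) (by simp)
  · rcases le_max_iff.1 (hle' ((z, s), (w, t)) trivial) with h1 | h1
    · exact (min_le_right _ _).trans h1
    · exact absurd (h1.trans_lt (max_lt hs ht)) (by simp)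

theorem abs_unitClamp_sub_le (x : ℝ) (t : I) : |(unitClamp x : ℝ) - t| ≤ |x - t| := by
  have := t.2.1
  have := t.2.2
  rw [coe_unitClamp]
  rcases le_total x 0 with h | h
  · rw [min_eq_right (by linarith), max_eq_left h, abs_sub_comm, abs_sub_comm x, abs_of_nonneg,
      abs_of_nonneg] <;> linarith
  · rcases le_total 1 x with h' | h'
    · rw [min_eq_left h', max_eq_right zero_le_one, abs_of_nonneg, abs_of_nonneg] <;> linarith
    · rw [min_eq_right h', max_eq_right h]

/-- Two separate mechanisms meet at time about `η`: near the ends the spatial maps are `η` apart and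
each moves by less than `η / 2`, while in the middle the new pairs coincide with the disjoint maps
into `X × ℝ`. -/
theorem IsNbhdRetraction.starSeparable {X : Type u} [MetricSpace X] {E : Type v}
    [NormedAddCommGroup E] [NormedSpace ℝ E] {k : X → E} {r : E → X} (H : IsNbhdRetraction k r)
    (hI : ApproxDisjoint X I I) (hS : ApproxDisjoint (X × ℝ) (I × I) (I × I))
    {Z₁ Z₂ : Type w} [TopologicalSpace Z₁] [CompactSpace Z₁] [T2Space Z₁] [TopologicalSpace Z₂]
    [CompactSpace Z₂] [T2Space Z₂] (hZ₁ : ArcCovered Z₁) (hZ₂ : ArcCovered Z₂)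
    (p₁ : TopographicalPair (Z₁ × I) X) (p₂ : TopographicalPair (Z₂ × I) X) :
    StarSeparable p₁ p₂ := by
  intro ε hε
  obtain ⟨f₁, f₂, hf₁, hf₂, hends⟩ := H.exists_approx_ends_disjoint hI hZ₁ hZ₂ p₁.spatial p₂.spatial
    (half_pos hε)
  obtain ⟨η, hη, hηd⟩ := exists_pos_le_dist_of_ne_ends f₁ f₂ hends
  have hε' : 0 < min (ε / 2) (η / 2) := lt_min (half_pos hε) (half_pos hη)
  obtain ⟨δ₁, hδ₁, hr₁⟩ := H.exists_delta_map f₁ hε'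
  obtain ⟨δ₂, hδ₂, hr₂⟩ := H.exists_delta_map f₂ hε'
  have hδ : 0 < min (min δ₁ δ₂) (η / 4) := lt_min (lt_min hδ₁ hδ₂) (by positivity)
  set δ := min (min δ₁ δ₂) (η / 4) with hδdef
  obtain ⟨G₁, G₂, hG₁, hG₂, hG⟩ := H.exists_approx_cylinders_disjoint hS hZ₁ hZ₂
    (f₁.prodMk ⟨fun z => (z.2 : ℝ), by fun_prop⟩) (f₂.prodMk ⟨fun z => (z.2 : ℝ), by fun_prop⟩) hδ
  have hk := H.continuous_left
  -- `μ` vanishes at both ends, which keeps the pairs in their categories, and equals 1 on `[η / 2,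
  -- 1 - η / 2]`.
  let μ : I → ℝ := fun t => min 1 (2 / η * min (t : ℝ) (1 - t))
  have hμc : Continuous μ := by fun_prop
  have hμ0 : ∀ t, 0 ≤ μ t := fun t => le_min zero_le_one
    (mul_nonneg (by positivity) (le_min t.2.1 (by linarith [t.2.2])))
  have hμ1 : ∀ t, μ t ≤ 1 := fun t => min_le_left _ _
  have hμm : ∀ t : I, η / 2 ≤ t → (t : ℝ) ≤ 1 - η / 2 → μ t = 1 := fun t h h' => by
    refine min_eq_left ?_
    rw [div_mul_eq_mul_div, one_le_div hη]
    linarith [le_min h (show η / 2 ≤ 1 - (t : ℝ) by linarith)]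
  have key : ∀ {Z : Type w} [TopologicalSpace Z] [CompactSpace Z] (f : C(Z × I, X))
      (G : C(Z × I, X × ℝ)), (∀ z, dist (G z) (f z, (z.2 : ℝ)) < δ) →
      (∀ g : Z × I → E, Continuous g → (∀ z, ‖g z - k (f z)‖ < δ) →
        ∃ F' : C(Z × I, X), (∀ z, F' z = r (g z)) ∧ ∀ z, dist (F' z) (f z) < min (ε / 2) (η / 2)) →
      ∃ q : TopographicalPair (Z × I) X, q.InCategory ∧
        (∀ z, dist (q.spatial z) (f z) < min (ε / 2) (η / 2)) ∧
        (∀ z, |(q.level z : ℝ) - z.2| < δ) ∧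
        ∀ z : Z × I, η / 2 ≤ (z.2 : ℝ) → (z.2 : ℝ) ≤ 1 - η / 2 →
          (q.spatial z, (q.level z : ℝ)) = G z := by
    intro Z _ _ f G hG hr
    have hG' : ∀ z, dist (G z).1 (f z) < δ ∧ |(G z).2 - z.2| < δ := fun z => by
      have := hG z
      rwa [Prod.dist_eq, max_lt_iff, Real.dist_eq] at this
    obtain ⟨F, hF, hFf⟩ := hr (fun z => k (f z) + μ z.2 • (k (G z).1 - k (f z))) (by fun_prop)
      (fun z => by
        rw [add_sub_cancel_left, norm_smul, H.norm_sub, Real.norm_of_nonneg (hμ0 _)]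
        exact (mul_le_of_le_one_left dist_nonneg (hμ1 _)).trans_lt (hG' z).1)
    refine ⟨⟨F, ⟨fun z => unitClamp (z.2 + μ z.2 * ((G z).2 - z.2)), by fun_prop⟩⟩, ?_, hFf, ?_, ?_⟩
    · intro z
      have e0 : μ 0 = 0 := by simp [μ]
      have e1 : μ 1 = 0 := by simp [μ]
      constructor
      · simpa [e0] using unitClamp_coe 0
      · simpa [e1] using unitClamp_coe 1
    · intro z
      refine (abs_unitClamp_sub_le _ _).trans_lt ?_
      rw [add_sub_cancel_left, abs_mul, abs_of_nonneg (hμ0 _)]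
      exact (mul_le_of_le_one_left (abs_nonneg _) (hμ1 _)).trans_lt (hG' z).2
    · intro z h h'
      have hz := hμm z.2 h h'
      have hδη : δ ≤ η / 4 := min_le_right _ _
      have h2 := abs_lt.1 (hG' z).2
      have e : (z.2 : ℝ) + μ z.2 * ((G z).2 - z.2) = (G z).2 := by rw [hz]; ring
      refine Prod.ext ?_ ?_
      · change F z = _
        rw [hF, hz, one_smul, add_sub_cancel, H.leftInv]
      · simp only [ContinuousMap.coe_mk, e]
        rw [coe_unitClamp, min_eq_right (by linarith), max_eq_right (by linarith)]
  obtain ⟨q₁, hq₁, hs₁, hl₁, hm₁⟩ := key f₁ G₁ hG₁ (fun g hg h => hr₁ g hg fun z =>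
    (h z).trans_le ((min_le_left _ _).trans (min_le_left _ _)))
  obtain ⟨q₂, hq₂, hs₂, hl₂, hm₂⟩ := key f₂ G₂ hG₂ (fun g hg h => hr₂ g hg fun z =>
    (h z).trans_le ((min_le_left _ _).trans (min_le_right _ _)))
  refine ⟨q₁, q₂, hq₁, hq₂, fun z => ?_, fun z => ?_, fun t => ?_⟩
  · linarith [dist_triangle (q₁.spatial z) (f₁ z) (p₁.spatial z), hf₁ z,
      (hs₁ z).trans_le (min_le_left _ _)]
  · linarith [dist_triangle (q₂.spatial z) (f₂ z) (p₂.spatial z), hf₂ z,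
      (hs₂ z).trans_le (min_le_left _ _)]
  · rw [Set.disjoint_left]
    rintro _ ⟨⟨z, s⟩, hz, rfl⟩ ⟨⟨w, s'⟩, hw, heq⟩
    have hlev : q₁.level (z, s) = q₂.level (w, s') := by
      rw [show q₁.level (z, s) = t from hz, show q₂.level (w, s') = t from hw]
    have b1 := abs_lt.1 (hl₁ (z, s))
    have b2 := abs_lt.1 (hl₂ (w, s'))
    rw [hlev] at b1
    have hδη : δ ≤ η / 4 := min_le_right _ _
    have hclose : dist (f₁ (z, s)) (f₂ (w, s')) < η := by
      have c1 := (hs₁ (z, s)).trans_le (min_le_right _ _)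
      have c2 := (hs₂ (w, s')).trans_le (min_le_right _ _)
      rw [heq] at c2
      linarith [dist_triangle_left (f₁ (z, s)) (f₂ (w, s')) (q₁.spatial (z, s))]
    -- Equal levels force `|s - s'| < η / 2`, as each level is within `η / 4` of its time. So if one
    -- time were within `η / 2` of an end, both would be within `η` of it, where the maps are far
    -- apart.
    have hfar : ¬ (((s : ℝ) < η ∧ (s' : ℝ) < η) ∨ 1 - (s : ℝ) < η ∧ 1 - (s' : ℝ) < η) :=
      fun hc => (hηd z w s s' hc).not_gt hclose
    simp only at b1 b2
    have m1 : η / 2 ≤ (s : ℝ) := by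
      by_contra! hc; exact hfar (Or.inl ⟨by linarith, by linarith⟩)
    have m2 : (s : ℝ) ≤ 1 - η / 2 := by
      by_contra! hc; exact hfar (Or.inr ⟨by linarith, by linarith⟩)
    have m3 : η / 2 ≤ (s' : ℝ) := by
      by_contra! hc; exact hfar (Or.inl ⟨by linarith, by linarith⟩)
    have m4 : (s' : ℝ) ≤ 1 - η / 2 := by
      by_contra! hc; exact hfar (Or.inr ⟨by linarith, by linarith⟩)
    apply hG (z, s) (w, s')
    rw [← hm₁ (z, s) m1 m2, ← hm₂ (w, s') m3 m4, heq, hlev]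

/-! ### The plane cross and its factorization through an arc -/

/-- The cross with four legs of length one in the plane. -/
def planeCross : Set (ℝ × ℝ) := {z | z.1 * z.2 = 0 ∧ ‖z‖ ≤ 1}

/-- The soft thresholding retraction of the plane onto the union of the two axes. -/
def softThreshold (z : ℝ × ℝ) : ℝ × ℝ :=
  (z.1 - max (-|z.2|) (min |z.2| z.1), z.2 - max (-|z.1|) (min |z.1| z.2))

@[fun_prop]
theorem continuous_softThreshold : Continuous softThreshold := by
  unfold softThreshold; fun_prop

theorem softThreshold_of_mul_eq_zero {z : ℝ × ℝ} (h : z.1 * z.2 = 0) : softThreshold z = z := by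
  obtain ⟨x, y⟩ := z
  rcases mul_eq_zero.1 h with h | h <;> simp only at h <;> subst h <;> ext <;> simp [softThreshold]

/-- The coordinate of smaller absolute value is sent to zero, and the other one shrinks. -/
theorem softThreshold_mem_planeCross {z : ℝ × ℝ} (h : ‖z‖ ≤ 1) : softThreshold z ∈ planeCross := by
  obtain ⟨x, y⟩ := z
  have hx : |x| ≤ 1 := (norm_fst_le (x, y)).trans h
  have hy : |y| ≤ 1 := (norm_snd_le (x, y)).trans h
  have aux : ∀ a b : ℝ, |a| ≤ 1 → |a - max (-|b|) (min |b| a)| ≤ 1 := by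
    intro a b ha
    have := abs_nonneg b
    rw [abs_le] at ha ⊢
    grind
  refine ⟨?_, ?_⟩
  · rcases le_total |x| |y| with hxy | hxy
    · refine mul_eq_zero_of_left ?_ _
      have := abs_le.1 hxy
      simp [softThreshold, min_eq_right this.2, max_eq_right this.1]
    · refine mul_eq_zero_of_right _ ?_
      have := abs_le.1 hxy
      simp [softThreshold, min_eq_right this.2, max_eq_right this.1]
  · simp only [Prod.norm_def, Real.norm_eq_abs, softThreshold]
    exact max_le (aux x y hx) (aux y x hy)

theorem planeCross_tip {z : ℝ × ℝ} (h : z ∈ planeCross) (h1 : ‖z‖ = 1) :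
    z = (1, 0) ∨ z = (0, 1) ∨ z = (-1, 0) ∨ z = (0, -1) := by
  obtain ⟨x, y⟩ := z
  have h0 := mul_eq_zero.1 h.1
  simp only [Prod.norm_def, Real.norm_eq_abs] at h0 h1
  rcases h0 with h0 | h0 <;> subst h0
  · rw [abs_zero, max_eq_right (abs_nonneg _)] at h1
    rcases eq_or_eq_neg_of_abs_eq h1 with h | h <;> simp [h]
  · rw [abs_zero, max_eq_left (abs_nonneg _)] at h1
    rcases eq_or_eq_neg_of_abs_eq h1 with h | h <;> simp [h]

theorem isCompact_planeCross : IsCompact planeCross := by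
  refine (isCompact_closedBall (0 : ℝ × ℝ) 1).of_isClosed_subset ?_ fun z hz => by simpa using hz.2
  exact (isClosed_eq (by fun_prop) continuous_const).inter
    (isClosed_le continuous_norm continuous_const)

/-- The identity of the cross is homotopic, within the cross and relative to its four tips, to a
map that factors through an arc. -/
theorem exists_planeCross_homotopy :
    ∃ (p : C(I, ℝ × ℝ)) (s : C(ℝ × ℝ, I)) (h : C((ℝ × ℝ) × I, ℝ × ℝ)),
      (∀ d, p d ∈ planeCross) ∧ (∀ z ∈ planeCross, h (z, 0) = z) ∧
      (∀ z t, ‖z‖ ≤ 1 → h (z, t) ∈ planeCross) ∧ (∀ z, h (z, 1) = p (s z)) ∧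
      ∀ z ∈ planeCross, ‖z‖ = 1 → ∀ t, h (z, t) = z := by
  let hat : ℝ → I → ℝ := fun i d => max 0 (1 - |3 * (d : ℝ) - i|)
  have hat0 : ∀ i d, 0 ≤ hat i d := fun i d => le_max_left _ _
  have hat1 : ∀ i d, hat i d ≤ 1 := fun i d =>
    max_le zero_le_one (by linarith [abs_nonneg (3 * (d : ℝ) - i)])
  -- The path `c` passes through the tips `(1,0)`, `(0,1)`, `(-1,0)`, `(0,-1)` at the parameters 0,
  -- 1/3, 2/3, 1.
  let c : I → ℝ × ℝ := fun d => (hat 0 d - hat 2 d, hat 1 d - hat 3 d)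
  have hcc : Continuous c := by fun_prop
  have hc1 : ∀ d, ‖c d‖ ≤ 1 := fun d => by
    simp only [c, Prod.norm_def, Real.norm_eq_abs]
    refine max_le ?_ ?_ <;> rw [abs_le]
    · exact ⟨by linarith [hat0 0 d, hat1 2 d], by linarith [hat0 2 d, hat1 0 d]⟩
    · exact ⟨by linarith [hat0 1 d, hat1 3 d], by linarith [hat0 3 d, hat1 1 d]⟩
  let p : C(I, ℝ × ℝ) := ⟨fun d => softThreshold (c d), by fun_prop⟩
  -- `s` gives each tip the parameter at which `c` visits it, so `p ∘ s` fixes the tips.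
  let s : C(ℝ × ℝ, I) :=
    ⟨fun z => unitClamp (1 / 3 * max z.2 0 + 2 / 3 * max (-z.1) 0 + max (-z.2) 0), by fun_prop⟩
  have hp : ∀ d, p d ∈ planeCross := fun d => softThreshold_mem_planeCross (hc1 d)
  have htip : ∀ z ∈ planeCross, ‖z‖ = 1 → p (s z) = z := by
    intro z hz hz1
    have hcz : ∀ x y : ℝ, ∀ d : I, z = (x, y) →
        max 0 (1 - |3 * (d : ℝ) - 0|) - max 0 (1 - |3 * (d : ℝ) - 2|) = x →
        max 0 (1 - |3 * (d : ℝ) - 1|) - max 0 (1 - |3 * (d : ℝ) - 3|) = y → p d = z := by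
      rintro x y d rfl hx hy
      have : c d = (x, y) := Prod.ext hx hy
      change softThreshold (c d) = _
      rw [this, softThreshold_of_mul_eq_zero hz.1]
    have hs : (s z : ℝ) =
      max 0 (min 1 (1 / 3 * max z.2 0 + 2 / 3 * max (-z.1) 0 + max (-z.2) 0)) := coe_unitClamp _
    rcases planeCross_tip hz hz1 with h | h | h | h <;> refine hcz _ _ _ h ?_ ?_ <;>
      rw [hs, h] <;> norm_num
  -- The straight-line homotopy from `z` to `p (s z)` stays in the convex unit ball and is pushed
  -- into the cross by `softThreshold`.
  refine ⟨p, s, ⟨fun q => softThreshold ((1 - (q.2 : ℝ)) • q.1 + (q.2 : ℝ) • p (s q.1)),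
    by fun_prop⟩, hp, ?_, ?_, ?_, ?_⟩
  · intro z hz
    simpa using softThreshold_of_mul_eq_zero hz.1
  · intro z t hz
    refine softThreshold_mem_planeCross ?_
    have := convex_closedBall (0 : ℝ × ℝ) 1 (by simpa using hz)
      (show p (s z) ∈ Metric.closedBall (0 : ℝ × ℝ) 1 by simpa using (hp (s z)).2)
      (show 0 ≤ 1 - (t : ℝ) by linarith [t.2.2]) t.2.1 (by ring)
    simpa using this
  · intro z
    simpa using softThreshold_of_mul_eq_zero (hp (s z)).1
  · intro z hz hz1 t
    have : (1 - (t : ℝ)) • z + (t : ℝ) • z = z := by rw [← add_smul]; simp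
    simp only [ContinuousMap.coe_mk, htip z hz hz1, this]
    exact softThreshold_of_mul_eq_zero hz.1

/-! ### Pushing one square off a cross-shaped wall -/

/-- The form in which (a) is applied: `α` gives the constant homotopy and `f` the square. End
conditions are kept only for `τ₁`, because the arc homotopy must be spliced into a longer wall
whereas the levels of the square are damped anyway. -/
theorem HasDcDStar.exists_disjoint {X : Type u} [MetricSpace X] (h : HasDcDStar X) (α : C(I, X))
    (f : C(I × I, X)) {ε : ℝ} (hε : 0 < ε) :
    ∃ (a b : C(I × I, X)) (τ₁ τ₂ : C(I × I, I)), (∀ x, τ₁ (x, 0) = 0 ∧ τ₁ (x, 1) = 1) ∧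
      (∀ z, dist (a z) (α z.1) < ε) ∧ (∀ z, dist (b z) (f z) < ε) ∧
        ∀ z w, a z = b w → τ₁ z ≠ τ₂ w := by
  obtain ⟨q₁, q₂, h₁, -, hd₁, hd₂, hd⟩ := h ⟨⟨fun z => α z.1, by fun_prop⟩, ⟨Prod.snd, by fun_prop⟩⟩
    ⟨f, ⟨Prod.snd, by fun_prop⟩⟩ ⟨fun _ => ⟨rfl, rfl⟩, fun _ _ _ => rfl, fun _ _ => rfl⟩
    (fun _ => ⟨rfl, rfl⟩) ε hε
  refine ⟨q₁.spatial, q₂.spatial, q₁.level, q₂.level, h₁, hd₁, hd₂, fun z w heq hlev => ?_⟩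
  exact Set.disjoint_left.1 (hd (q₁.level z)) ⟨z, rfl, rfl⟩ ⟨w, hlev.symm, heq.symm⟩

/-- The boundary of the unit square. -/
def squareBoundary : Set (I × I) := {u | u.1 = 0 ∨ u.1 = 1 ∨ u.2 = 0 ∨ u.2 = 1}

theorem isClosed_squareBoundary : IsClosed squareBoundary := by
  have h1 : ∀ c : I, IsClosed {u : I × I | u.1 = c} := fun c =>
    isClosed_eq continuous_fst continuous_const
  have h2 : ∀ c : I, IsClosed {u : I × I | u.2 = c} := fun c =>
    isClosed_eq continuous_snd continuous_const
  exact (h1 0).union ((h1 1).union ((h2 0).union (h2 1)))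

/-- A level function on `J × ℝ`, equal to the given one (shifted by `1 / 2`) for `|s| ≤ 1 / 2` and
to `s` elsewhere. -/
theorem exists_level_extension {J : Type*} [TopologicalSpace J] (τ : C(J × I, I))
    (hτ : ∀ x, τ (x, 0) = 0 ∧ τ (x, 1) = 1) :
    ∃ G : C(J × ℝ, ℝ), (∀ x s, 1 / 2 ≤ |s| → G (x, s) = s) ∧
      (∀ x s, |s| ≤ 1 / 2 → G (x, s) = τ (x, unitClamp (s + 1 / 2)) - 1 / 2) ∧
      ∀ x s, |s| < 1 → |G (x, s)| < 1 := by
  let G : C(J × ℝ, ℝ) := ⟨fun p => τ (p.1, unitClamp (p.2 + 1 / 2)) - 1 / 2 +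
    (p.2 - max (-1 / 2) (min (1 / 2) p.2)), by fun_prop⟩
  have h1 : ∀ x s, 1 / 2 ≤ |s| → G (x, s) = s := by
    intro x s hs
    rcases le_abs.1 hs with h | h
    · have : unitClamp (s + 1 / 2) = 1 := Subtype.ext (by
        rw [coe_unitClamp, min_eq_left (by linarith), max_eq_right zero_le_one]; rfl)
      simp only [G, ContinuousMap.coe_mk, this, hτ, min_eq_left h]
      norm_num
    · have : unitClamp (s + 1 / 2) = 0 := Subtype.ext (by
        rw [coe_unitClamp, max_eq_left (min_le_of_right_le (by linarith))]; rfl)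
      simp only [G, ContinuousMap.coe_mk, this, hτ, min_eq_right (show s ≤ 1 / 2 by linarith),
        max_eq_left (show s ≤ -1 / 2 by linarith)]
      norm_num
  have h2 : ∀ x s, |s| ≤ 1 / 2 → G (x, s) = τ (x, unitClamp (s + 1 / 2)) - 1 / 2 := by
    intro x s hs
    have := abs_le.1 hs
    simp only [G, ContinuousMap.coe_mk, min_eq_right this.2,
      max_eq_right (show -1 / 2 ≤ s by linarith)]
    ring
  refine ⟨G, h1, h2, fun x s hs => ?_⟩
  rcases le_total |s| (1 / 2) with h | h
  · rw [h2 x s h, abs_lt]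
    have := (τ (x, unitClamp (s + 1 / 2))).2
    constructor <;> linarith [this.1, this.2]
  · rwa [h1 x s h]

theorem unitClamp_eq_one {x : ℝ} (h : 1 ≤ x) : unitClamp x = 1 := Subtype.ext (by
  rw [coe_unitClamp, min_eq_left h, max_eq_right zero_le_one]; rfl)

theorem unitClamp_eq_zero {x : ℝ} (h : x ≤ 0) : unitClamp x = 0 := Subtype.ext (by
  rw [coe_unitClamp, max_eq_left (min_le_of_right_le h)]; rfl)

/-- A square `h` is made disjoint from a wall `γ(A) × ℝ` that, near the square, is a cross. The wall
changes by displacements `D`, `Δ` of the spatial and level coordinates, the square by `d`, `q`. -/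
theorem IsNbhdRetraction.exists_cross_displacement {X : Type u} [MetricSpace X] {E : Type v}
    [NormedAddCommGroup E] [NormedSpace ℝ E] {k : X → E} {r : E → X} (H : IsNbhdRetraction k r)
    (ha : HasDcDStar X) (γ : C(ℝ × ℝ, X)) (h : C(I × I, X)) {A : Set (ℝ × ℝ)} (hA : IsCompact A)
    (hA₁ : ∀ z ∈ A, ‖z‖ < 1 → z ∈ planeCross)
    (h₁ : ∀ u ∈ squareBoundary, ∀ z ∈ A ∪ planeCross, h u ≠ γ z)
    (h₂ : ∀ z ∈ A, 1 ≤ ‖z‖ → ∀ u, h u ≠ γ z) {ω : ℝ}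
    (hω : ∀ z ∈ planeCross, ∀ w ∈ planeCross, dist (γ z) (γ w) ≤ ω) {ζ : ℝ} (hζ : 0 < ζ) :
    ∃ (D : (ℝ × ℝ) × ℝ → E) (Δ : (ℝ × ℝ) × ℝ → ℝ) (d : I × I → E) (q : I × I → ℝ),
      Continuous D ∧ Continuous Δ ∧ Continuous d ∧ Continuous q ∧
      (∀ z s, 1 ≤ ‖z‖ ∨ 1 ≤ |s| → D (z, s) = 0 ∧ Δ (z, s) = 0) ∧
      (∀ z s, |s| < 1 → |s + Δ (z, s)| < 1) ∧ (∀ z s, ‖D (z, s)‖ ≤ ω + ζ) ∧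
      (∀ z ∈ A, ∀ s, ∃ z' ∈ A ∪ planeCross, dist (r (k (γ z) + D (z, s))) (γ z') < ζ) ∧
      (∀ u ∈ squareBoundary, d u = 0 ∧ q u = 0) ∧ (∀ u, |q u| < 1) ∧ (∀ u, ‖d u‖ ≤ ζ) ∧
      ∀ z ∈ A, ∀ s u, |s| < 1 → r (k (γ z) + D (z, s)) = r (k (h u) + d u) →
        s + Δ (z, s) ≠ q u := by
  obtain ⟨p, s₀, hh, hp, hh0, hhc, hh1, hht⟩ := exists_planeCross_homotopy
  have hk := H.continuous_left
  -- separation constants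
  obtain ⟨η₁, hη₁, hs₁⟩ := (isClosed_squareBoundary.isCompact.image h.continuous).exists_pos_le_dist
    ((hA.union isCompact_planeCross).image γ.continuous) (by
      rw [Set.disjoint_left]
      rintro _ ⟨u, hu, rfl⟩ ⟨z, hz, he⟩
      exact h₁ u hu z hz he.symm)
  have hA₂ : IsCompact (A ∩ {z | 1 ≤ ‖z‖}) :=
    hA.inter_right (isClosed_le continuous_const continuous_norm)
  obtain ⟨η₂, hη₂, hs₂⟩ := (isCompact_range h.continuous).exists_pos_le_dist
    (hA₂.image γ.continuous) (by
      rw [Set.disjoint_left]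
      rintro _ ⟨u, rfl⟩ ⟨z, hz, he⟩
      exact h₂ z hz.1 hz.2 u he.symm)
  set η := min η₁ η₂
  have hη : 0 < η := lt_min hη₁ hη₂
  have hs₁' : ∀ u ∈ squareBoundary, ∀ z ∈ A ∪ planeCross, η ≤ dist (h u) (γ z) :=
    fun u hu z hz => (min_le_left _ _).trans (hs₁ _ ⟨u, hu, rfl⟩ _ ⟨z, hz, rfl⟩)
  have hs₂' : ∀ z ∈ A, 1 ≤ ‖z‖ → ∀ u, η ≤ dist (h u) (γ z) :=
    fun z hz hz1 u => (min_le_right _ _).trans (hs₂ _ ⟨u, rfl⟩ _ ⟨z, ⟨hz, hz1⟩, rfl⟩)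
  -- accuracy
  have hε : 0 < min ζ (η / 8) := lt_min hζ (by positivity)
  set ε := min ζ (η / 8) with hεdef
  have : CompactSpace planeCross := isCompact_iff_compactSpace.1 isCompact_planeCross
  obtain ⟨δ₁, hδ₁, hr₁⟩ := H.exists_delta (⟨fun z : planeCross => γ z, by fun_prop⟩ : C(planeCross, X))
    hε
  obtain ⟨δ₂, hδ₂, hr₂⟩ := H.exists_delta h hε
  have hδ : 0 < min (min δ₁ δ₂) ζ := lt_min (lt_min hδ₁ hδ₂) hζ
  obtain ⟨a, b, τ₁, τ₂, hτ₁, haα, hbh, hab⟩ := ha.exists_disjoint (γ.comp p) h hδ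
  set δ := min (min δ₁ δ₂) ζ with hδdef
  have hδ1 : δ ≤ δ₁ := (min_le_left _ _).trans (min_le_left _ _)
  have hδ2 : δ ≤ δ₂ := (min_le_left _ _).trans (min_le_right _ _)
  have hδ3 : δ ≤ ζ := min_le_right _ _
  -- the cut-off function on the wall
  let N : Set (ℝ × ℝ) := {z | z ∈ A ∩ planeCross ∧ ∃ t u, dist (h u) (γ (hh (z, t))) ≤ η / 2}
  have hN : IsClosed N := by
    have hc : IsCompact (((A ∩ planeCross) ×ˢ (Set.univ : Set (I × (I × I)))) ∩
        {x | dist (h x.2.2) (γ (hh (x.1, x.2.1))) ≤ η / 2}) :=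
      ((hA.inter_right isCompact_planeCross.isClosed).prod isCompact_univ).inter_right
        (isClosed_le (by fun_prop) continuous_const)
    convert (hc.image continuous_fst).isClosed using 1
    ext z
    constructor
    · rintro ⟨hz, t, u, hu⟩
      exact ⟨(z, (t, u)), ⟨⟨hz, trivial⟩, hu⟩, rfl⟩
    · rintro ⟨⟨z, t, u⟩, ⟨⟨hz, -⟩, hu⟩, rfl⟩
      exact ⟨hz, t, u, hu⟩
  -- The two closed sets are disjoint because the homotopy fixes the tips, and the tips lying in `A`
  -- are `η` away from the square.
  obtain ⟨μ, hμ0, hμ1, hμ⟩ := exists_continuous_zero_one_of_isClosed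
    (isClosed_le (continuous_const (y := (1 : ℝ))) (continuous_norm (E := ℝ × ℝ))) hN (by
      rw [Set.disjoint_left]
      rintro z (hz : 1 ≤ ‖z‖) ⟨⟨hzA, hzc⟩, t, u, hu⟩
      rw [hht z hzc (le_antisymm hzc.2 hz)] at hu
      linarith [hs₂' z hzA hz u])
  -- the cut-off function on the square
  let C : Set (I × I) := {u | ∃ z ∈ A ∪ planeCross, dist (h u) (γ z) ≤ η / 2}
  have hC : IsClosed C := by
    have hc : IsCompact (((Set.univ : Set (I × I)) ×ˢ (A ∪ planeCross)) ∩
        {x | dist (h x.1) (γ x.2) ≤ η / 2}) :=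
      (isCompact_univ.prod (hA.union isCompact_planeCross)).inter_right
        (isClosed_le (by fun_prop) continuous_const)
    convert (hc.image continuous_fst).isClosed using 1
    ext u
    constructor
    · rintro ⟨z, hz, hu⟩
      exact ⟨(u, z), ⟨⟨trivial, hz⟩, hu⟩, rfl⟩
    · rintro ⟨⟨u, z⟩, ⟨⟨-, hz⟩, hu⟩, rfl⟩
      exact ⟨z, hz, hu⟩
  obtain ⟨κ, hκ0, hκ1, hκ⟩ := exists_continuous_zero_one_of_isClosed isClosed_squareBoundary hC (by
      rw [Set.disjoint_left]
      rintro u hu ⟨z, hz, hd⟩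
      linarith [hs₁' u hu z hz])
  obtain ⟨G, hG1, hG2, hG3⟩ := exists_level_extension τ₁ hτ₁
  -- the motion of the wall
  let t₁ : (ℝ × ℝ) × ℝ → I := fun x => unitClamp (μ x.1 * unitClamp (4 * (1 - |x.2|)))
  -- Where `μ = 1`: as `|s|` falls from 1 to 3/4 the wall runs through the cross homotopy, from 3/4
  -- to 1/2 it passes from `γ ∘ p ∘ s₀` to the homotopy `a`, and for `|s| ≤ 1/2` it follows `a`.
  let t₂ : ℝ → I := fun s => unitClamp (4 * (3 / 4 - |s|))
  let m : (ℝ × ℝ) × ℝ → E := fun x => (μ x.1 * t₂ x.2) •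
    (k (a (s₀ x.1, unitClamp (x.2 + 1 / 2))) - k (γ (p (s₀ x.1))))
  let V : (ℝ × ℝ) × ℝ → E := fun x => k (γ (hh (x.1, t₁ x))) + m x
  have hm : ∀ x, ‖m x‖ < δ := fun x => by
    have e1 : ‖k (a (s₀ x.1, unitClamp (x.2 + 1 / 2))) - k (γ (p (s₀ x.1)))‖ < δ := by
      rw [H.norm_sub]; exact haα _
    have e2 : 0 ≤ μ x.1 * t₂ x.2 := mul_nonneg (hμ _).1 (t₂ x.2).2.1
    have e3 : μ x.1 * t₂ x.2 ≤ 1 := mul_le_one₀ (hμ _).2 (t₂ x.2).2.1 (t₂ x.2).2.2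
    rw [norm_smul, Real.norm_of_nonneg e2]
    exact (mul_le_of_le_one_left (norm_nonneg _) e3).trans_lt e1
  have hD0 : ∀ z s, 1 ≤ ‖z‖ ∨ 1 ≤ |s| → t₁ (z, s) = 0 ∧ m (z, s) = 0 := by
    rintro z s (hz | hs)
    · have : μ z = 0 := hμ0 hz
      exact ⟨by simp [t₁, this, unitClamp_eq_zero], by simp [m, this]⟩
    · have e1 : unitClamp (4 * (1 - |s|)) = 0 := unitClamp_eq_zero (by linarith)
      have e2 : t₂ s = 0 := unitClamp_eq_zero (by linarith)
      exact ⟨by simp [t₁, e1, unitClamp_eq_zero], by simp [m, e2]⟩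
  let D : (ℝ × ℝ) × ℝ → E := fun x => V x - k (γ (hh (x.1, 0)))
  let Δ : (ℝ × ℝ) × ℝ → ℝ := fun x => μ x.1 * (G (s₀ x.1, x.2) - x.2)
  let d : I × I → E := fun u => κ u • (k (b u) - k (h u))
  let q : I × I → ℝ := fun u => κ u * (τ₂ u - 1 / 2)
  have hd : ∀ u, ‖d u‖ < δ := fun u => by
    have e1 : ‖k (b u) - k (h u)‖ < δ := by rw [H.norm_sub]; exact hbh _
    rw [norm_smul, Real.norm_of_nonneg (hκ u).1]
    exact (mul_le_of_le_one_left (norm_nonneg _) (hκ u).2).trans_lt e1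
  have hq : ∀ u, |q u| ≤ 1 / 2 := fun u => by
    have e1 : |(τ₂ u : ℝ) - 1 / 2| ≤ 1 / 2 := abs_le.2 ⟨by linarith [(τ₂ u).2.1],
      by linarith [(τ₂ u).2.2]⟩
    rw [abs_mul, abs_of_nonneg (hκ u).1]
    exact (mul_le_of_le_one_left (abs_nonneg _) (hκ u).2).trans e1
  have hwall : ∀ z ∈ A, ‖z‖ < 1 → ∀ s, k (γ z) + D (z, s) = V (z, s) ∧
      dist (r (k (γ z) + D (z, s))) (γ (hh (z, t₁ (z, s)))) < ε := by
    intro z hz hz1 s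
    have e : k (γ z) + D (z, s) = V (z, s) := by
      simp only [D, hh0 z (hA₁ z hz hz1), add_sub_cancel]
    refine ⟨e, ?_⟩
    rw [e]
    refine (hr₁ ⟨hh (z, t₁ (z, s)), hhc z _ hz1.le⟩ _ ?_).2
    simpa [V] using (hm (z, s)).trans_le hδ1
  refine ⟨D, Δ, d, q, by fun_prop, by fun_prop, by fun_prop, by fun_prop, ?_, ?_, ?_, ?_, ?_, ?_, ?_,
    ?_⟩
  · intro z s hzs
    refine ⟨?_, ?_⟩
    · simp [D, V, hD0 z s hzs]
    · rcases hzs with hz | hs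
      · have : μ z = 0 := hμ0 hz
        simp [Δ, this]
      · simp [Δ, hG1 (s₀ z) s (by linarith)]
  · intro z s hs
    have e : s + Δ (z, s) = (1 - μ z) • s + μ z • G (s₀ z, s) := by
      simp only [Δ, smul_eq_mul]; ring
    have := convex_ball (0 : ℝ) 1 (show s ∈ _ by simpa using hs)
      (show G (s₀ z, s) ∈ _ by simpa using hG3 (s₀ z) s hs)
      (show 0 ≤ 1 - μ z by linarith [(hμ z).2]) (hμ z).1 (by ring)
    rw [e]
    simpa using this
  · intro z s
    have hω0 : 0 ≤ ω := dist_nonneg.trans (hω _ (hp 0) _ (hp 0))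
    rcases le_total ‖z‖ 1 with hz | hz
    · have e : D (z, s) = (k (γ (hh (z, t₁ (z, s)))) - k (γ (hh (z, 0)))) + m (z, s) := by
        simp only [D, V]; abel
      rw [e]
      refine (norm_add_le _ _).trans (add_le_add ?_ ((hm _).le.trans hδ3))
      rw [H.norm_sub]
      exact hω _ (hhc _ _ hz) _ (hhc _ _ hz)
    · simp only [D, V, hD0 z s (Or.inl hz)]
      simpa using add_nonneg hω0 hζ.le
  · intro z hz s
    rcases lt_or_ge ‖z‖ 1 with hz1 | hz1
    · exact ⟨_, Or.inr (hhc z _ hz1.le), (hwall z hz hz1 s).2.trans_le (min_le_left _ _)⟩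
    · refine ⟨z, Or.inl hz, ?_⟩
      simpa [D, V, hD0 z s (Or.inl hz1), H.leftInv] using hζ
  · intro u hu
    have : κ u = 0 := hκ0 hu
    simp [d, q, this]
  · intro u
    linarith [hq u]
  · exact fun u => (hd u).le.trans hδ3
  · intro z hz s u hs heq hlev
    have hPu : dist (r (k (h u) + d u)) (h u) < ε :=
      (hr₂ u _ (by simpa using (hd u).trans_le hδ2)).2
    have hεη : ε ≤ η / 8 := min_le_right _ _
    rcases lt_or_ge ‖z‖ 1 with hz1 | hz1
    · obtain ⟨e1, e2⟩ := hwall z hz hz1 s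
      have hzc := hA₁ z hz hz1
      have hclose : dist (h u) (γ (hh (z, t₁ (z, s)))) ≤ η / 2 := by
        rw [heq] at e2
        linarith [dist_triangle_left (h u) (γ (hh (z, t₁ (z, s)))) (r (k (h u) + d u))]
      -- A coincidence puts the original square and the track of the wall within `η / 2`, so both
      -- cut-offs are 1 and the undamped formulas hold.
      have hκu : κ u = 1 := hκ1 ⟨_, Or.inr (hhc z _ hz1.le), hclose⟩
      have hμz : μ z = 1 := hμ1 ⟨⟨hz, hzc⟩, _, u, hclose⟩
      have hlev' : G (s₀ z, s) = q u := by
        rw [← hlev]; simp only [Δ, hμz]; ring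
      have hP : r (k (h u) + d u) = b u := by
        simp [d, hκu, H.leftInv]
      -- In the middle range (a) gives disjointness; outside it the wall has level `s` with `|s| >
      -- 1/2`, above or below every level of the square.
      rcases le_or_gt |s| (1 / 2) with hs2 | hs2
      · have c1 : unitClamp (4 * (1 - |s|)) = 1 := unitClamp_eq_one (by linarith)
        have c2 : t₂ s = 1 := unitClamp_eq_one (by linarith)
        have c3 : t₁ (z, s) = 1 := by simp [t₁, c1, hμz, unitClamp_eq_one]
        have hS : r (k (γ z) + D (z, s)) = a (s₀ z, unitClamp (s + 1 / 2)) := by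
          rw [e1]
          simp [V, m, c2, c3, hμz, hh1, H.leftInv]
        rw [hG2 _ _ hs2] at hlev'
        refine hab _ _ (by rw [← hS, ← hP, heq]) (Subtype.ext ?_)
        simp only [q, hκu, one_mul] at hlev'
        linarith
      · rw [hG1 _ _ hs2.le] at hlev'
        have := hq u
        rw [← hlev'] at this
        linarith
    · have e : r (k (γ z) + D (z, s)) = γ z := by
        simp [D, V, hD0 z s (Or.inl hz1), H.leftInv]
      rw [← heq, e, dist_comm] at hPu
      linarith [hs₂' z hz hz1 u]

/-! ### Grids and cells in the unit square -/

/-- The affine map from the unit interval onto `[i / M, (i + 1) / M]`. -/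
noncomputable def cellMap (M i : ℕ) : C(I, I) := ⟨fun u => unitClamp ((i + u) / M), by fun_prop⟩

/-- The retraction of the unit interval to `[i / M, (i + 1) / M]`, followed by the inverse of
`cellMap M i`. -/
noncomputable def cellInv (M i : ℕ) : C(I, I) := ⟨fun x => unitClamp (M * x - i), by fun_prop⟩

theorem coe_unitClamp_of_mem {x : ℝ} (h : 0 ≤ x) (h' : x ≤ 1) : (unitClamp x : ℝ) = x := by
  rw [coe_unitClamp, min_eq_right h', max_eq_right h]

theorem mul_cellMap {M i : ℕ} (h : i < M) (u : I) : (M : ℝ) * cellMap M i u = i + u := by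
  have hM : (0 : ℝ) < M := by exact_mod_cast (Nat.zero_le i).trans_lt h
  have h1 : (i : ℝ) + 1 ≤ M := by exact_mod_cast h
  change (M : ℝ) * (unitClamp ((i + u) / M) : ℝ) = _
  rw [coe_unitClamp_of_mem (div_nonneg (add_nonneg i.cast_nonneg u.2.1) hM.le)
    ((div_le_one hM).2 (by linarith [u.2.2]))]
  field_simp

theorem cellInv_cellMap {M i : ℕ} (h : i < M) (u : I) : cellInv M i (cellMap M i u) = u := by
  change unitClamp ((M : ℝ) * cellMap M i u - i) = u
  rw [mul_cellMap h, add_sub_cancel_left, unitClamp_coe]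

theorem cellMap_cellInv {M i : ℕ} (h : i < M) {x : I} (h1 : (i : ℝ) ≤ M * x)
    (h2 : (M : ℝ) * x ≤ i + 1) : cellMap M i (cellInv M i x) = x := by
  have hM : (0 : ℝ) < M := by exact_mod_cast (Nat.zero_le i).trans_lt h
  apply Subtype.ext
  apply mul_left_cancel₀ hM.ne'
  rw [mul_cellMap h]
  change (i : ℝ) + (unitClamp (M * x - i) : ℝ) = _
  rw [coe_unitClamp_of_mem (by linarith) (by linarith)]
  ring

theorem cellInv_eq_zero_or_one {M i : ℕ} {x : I} (h : ¬ ((i : ℝ) < M * x ∧ (M : ℝ) * x < i + 1)) :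
    cellInv M i x = 0 ∨ cellInv M i x = 1 := by
  rw [not_and_or, not_lt, not_lt] at h
  rcases h with h | h
  · exact Or.inl (unitClamp_eq_zero (by linarith))
  · exact Or.inr (unitClamp_eq_one (by linarith))

/-- The grid of mesh `1 / M` in the unit square. -/
def gridSet (M : ℕ) : Set (I × I) :=
  {z | (∃ n : ℤ, (M : ℝ) * z.1 = n) ∨ ∃ n : ℤ, (M : ℝ) * z.2 = n}

/-- The open cells of the grid of mesh `1 / M` in the unit square. -/
def openCell (M : ℕ) (b : Fin M × Fin M) : Set (I × I) :=
  {z | ((b.1 : ℝ) < M * z.1 ∧ (M : ℝ) * z.1 < b.1 + 1) ∧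
    (b.2 : ℝ) < M * z.2 ∧ (M : ℝ) * z.2 < b.2 + 1}

/-- The closed cells of the grid of mesh `1 / M` in the unit square. -/
def closedCell (M : ℕ) (b : Fin M × Fin M) : Set (I × I) :=
  {z | ((b.1 : ℝ) ≤ M * z.1 ∧ (M : ℝ) * z.1 ≤ b.1 + 1) ∧
    (b.2 : ℝ) ≤ M * z.2 ∧ (M : ℝ) * z.2 ≤ b.2 + 1}

theorem openCell_subset_closedCell (M : ℕ) (b : Fin M × Fin M) : openCell M b ⊆ closedCell M b :=
  fun _ h => ⟨⟨h.1.1.le, h.1.2.le⟩, h.2.1.le, h.2.2.le⟩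

theorem not_isInt_of_lt_of_lt {i : ℕ} {x : ℝ} (h1 : (i : ℝ) < x) (h2 : x < i + 1) (n : ℤ) :
    x ≠ n := by
  rintro rfl
  have h1 : (i : ℤ) < n := by exact_mod_cast h1
  have h2 : n < (i : ℤ) + 1 := by exact_mod_cast h2
  omega

theorem notMem_openCell_of_mem_gridSet {M : ℕ} {z : I × I} (hz : z ∈ gridSet M)
    (b : Fin M × Fin M) : z ∉ openCell M b := by
  rintro ⟨⟨h1, h2⟩, h3, h4⟩
  rcases hz with ⟨n, hn⟩ | ⟨n, hn⟩
  · exact not_isInt_of_lt_of_lt h1 h2 n hn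
  · exact not_isInt_of_lt_of_lt h3 h4 n hn

/-- The integer part of `M * x`, for `x < 1`. -/
theorem exists_fin_le_lt {M : ℕ} (x : I) (hx : (M : ℝ) * x < M) :
    ∃ i : Fin M, (i : ℝ) ≤ M * x ∧ (M : ℝ) * x < i + 1 := by
  have h0 : 0 ≤ (M : ℝ) * x := mul_nonneg M.cast_nonneg x.2.1
  refine ⟨⟨⌊(M : ℝ) * x⌋₊, (Nat.floor_lt h0).2 hx⟩, Nat.floor_le h0, Nat.lt_floor_add_one _⟩

theorem exists_fin_le_le {M : ℕ} (hM : 0 < M) (x : I) :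
    ∃ i : Fin M, (i : ℝ) ≤ M * x ∧ (M : ℝ) * x ≤ i + 1 := by
  have hM' : (0 : ℝ) < M := by exact_mod_cast hM
  rcases (mul_le_of_le_one_right hM'.le x.2.2).lt_or_eq with h | h
  · obtain ⟨i, h1, h2⟩ := exists_fin_le_lt x h
    exact ⟨i, h1, h2.le⟩
  · refine ⟨⟨M - 1, by omega⟩, ?_⟩
    rw [h, Nat.cast_sub (by omega)]
    constructor <;> simp

theorem exists_fin_lt_lt {M : ℕ} (hM : 0 < M) {x : I} (hx : ¬ ∃ n : ℤ, (M : ℝ) * x = n) :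
    ∃ i : Fin M, (i : ℝ) < M * x ∧ (M : ℝ) * x < i + 1 := by
  obtain ⟨i, h1, h2⟩ := exists_fin_le_le hM x
  refine ⟨i, h1.lt_of_ne fun h => hx ⟨i, ?_⟩, h2.lt_of_ne fun h => hx ⟨i + 1, ?_⟩⟩
  · rw [← h]; norm_cast
  · rw [h]; norm_cast

theorem exists_mem_openCell {M : ℕ} (hM : 0 < M) {z : I × I} (hz : z ∉ gridSet M) :
    ∃ b, z ∈ openCell M b := by
  rw [gridSet, Set.mem_ofPred_eq, not_or] at hz
  obtain ⟨i, hi⟩ := exists_fin_lt_lt hM hz.1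
  obtain ⟨j, hj⟩ := exists_fin_lt_lt hM hz.2
  exact ⟨(i, j), hi, hj⟩

theorem eq_of_mem_openCell_of_mem_closedCell {M : ℕ} {z : I × I} {b b' : Fin M × Fin M}
    (h : z ∈ openCell M b) (h' : z ∈ closedCell M b') : b' = b := by
  have aux : ∀ {i j : Fin M} {x : ℝ}, (i : ℝ) < x → x < i + 1 → (j : ℝ) ≤ x → x ≤ j + 1 → j = i := by
    intro i j x h1 h2 h3 h4
    have a1 : (j : ℕ) < i + 1 := by exact_mod_cast h3.trans_lt h2
    have a2 : (i : ℕ) < j + 1 := by exact_mod_cast h1.trans_le h4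
    exact Fin.ext (by omega)
  exact Prod.ext (aux h.1.1 h.1.2 h'.1.1 h'.1.2) (aux h.2.1 h.2.2 h'.2.1 h'.2.2)

theorem isCompact_gridSet (M : ℕ) : IsCompact (gridSet M) := by
  apply IsClosed.isCompact
  have hZ : IsClosed (Set.range ((↑) : ℤ → ℝ)) := Int.isClosedEmbedding_coe_real.isClosed_range
  have h1 : IsClosed {z : I × I | ∃ n : ℤ, (M : ℝ) * z.1 = n} := by
    convert hZ.preimage (f := fun z : I × I => (M : ℝ) * z.1) (by fun_prop) using 1
    ext z; simp [eq_comm]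
  have h2 : IsClosed {z : I × I | ∃ n : ℤ, (M : ℝ) * z.2 = n} := by
    convert hZ.preimage (f := fun z : I × I => (M : ℝ) * z.2) (by fun_prop) using 1
    ext z; simp [eq_comm]
  exact h1.union h2

/-- The parametrized edges of the grid of mesh `1 / M`. -/
noncomputable def gridEdge (M : ℕ) (e : Bool × Fin M × Fin (M + 1)) : C(I, I × I) :=
  if e.1 then ⟨fun u => (cellMap M e.2.1 u, unitClamp (e.2.2 / M)), by fun_prop⟩
  else ⟨fun u => (unitClamp (e.2.2 / M), cellMap M e.2.1 u), by fun_prop⟩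

/-- Retractions onto the edges of the grid. -/
noncomputable def gridEdgeInv (M : ℕ) (e : Bool × Fin M × Fin (M + 1)) : C(I × I, I) :=
  if e.1 then ⟨fun z => cellInv M e.2.1 z.1, by fun_prop⟩
  else ⟨fun z => cellInv M e.2.1 z.2, by fun_prop⟩

theorem gridEdgeInv_gridEdge (M : ℕ) (e : Bool × Fin M × Fin (M + 1)) (u : I) :
    gridEdgeInv M e (gridEdge M e u) = u := by
  obtain ⟨_ | _, i, j⟩ := e <;> simp [gridEdge, gridEdgeInv, cellInv_cellMap i.2]

theorem exists_gridEdge {M : ℕ} (hM : 0 < M) {z : I × I} (hz : z ∈ gridSet M) :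
    ∃ e u, gridEdge M e u = z := by
  have hM' : (0 : ℝ) < M := by exact_mod_cast hM
  have aux : ∀ x : I, (∃ n : ℤ, (M : ℝ) * x = n) →
      ∃ j : Fin (M + 1), unitClamp ((j : ℝ) / M) = x := by
    rintro x ⟨n, hn⟩
    have h0 : (0 : ℝ) ≤ n := hn ▸ mul_nonneg hM'.le x.2.1
    have h1 : (n : ℝ) ≤ M := hn ▸ mul_le_of_le_one_right hM'.le x.2.2
    lift n to ℕ using by exact_mod_cast h0
    refine ⟨⟨n, Nat.lt_succ_of_le (by exact_mod_cast h1)⟩, ?_⟩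
    rw [← unitClamp_coe x]
    congr 1
    rw [div_eq_iff hM'.ne', mul_comm, hn]
    simp
  rcases hz with h | h
  · obtain ⟨j, hj⟩ := aux _ h
    obtain ⟨i, h1, h2⟩ := exists_fin_le_le hM z.2
    refine ⟨(false, i, j), cellInv M i z.2, ?_⟩
    simp [gridEdge, hj, cellMap_cellInv i.2 h1 h2]
  · obtain ⟨j, hj⟩ := aux _ h
    obtain ⟨i, h1, h2⟩ := exists_fin_le_le hM z.1
    refine ⟨(true, i, j), cellInv M i z.1, ?_⟩
    simp [gridEdge, hj, cellMap_cellInv i.2 h1 h2]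

theorem dist_gridEdge_le {M : ℕ} (e : Bool × Fin M × Fin (M + 1)) (u v : I) :
    dist (gridEdge M e u) (gridEdge M e v) ≤ 1 / M := by
  have aux : ∀ i : Fin M, dist (cellMap M i u) (cellMap M i v) ≤ 1 / M := by
    intro i
    have hM' : (0 : ℝ) < M := by exact_mod_cast (Nat.zero_le _).trans_lt i.2
    have h1 := mul_cellMap i.2 u
    have h2 := mul_cellMap i.2 v
    rw [Subtype.dist_eq, Real.dist_eq, le_div_iff₀ hM', ← abs_of_pos hM', ← abs_mul,
      sub_mul, mul_comm _ (M : ℝ), h1, mul_comm _ (M : ℝ), h2, abs_le]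
    constructor <;> linarith [u.2.1, u.2.2, v.2.1, v.2.2]
  obtain ⟨_ | _, i, j⟩ := e <;> simpa [gridEdge, Prod.dist_eq] using aux i

/-- General position for the edges of both grids, with the two maps read as one map on `Bool × (I ×
I)`. Two edges that meet have union of diameter at most `2 / M`, so points farther apart lie on
disjoint edges. -/
theorem IsNbhdRetraction.exists_approx_grid {X : Type u} [MetricSpace X] {E : Type v}
    [NormedAddCommGroup E] [NormedSpace ℝ E] {k : X → E} {r : E → X} (H : IsNbhdRetraction k r)
    (hI : ApproxDisjoint X I I) {M : ℕ} (hM : 0 < M) (F : Bool → C(I × I, X)) {ε : ℝ}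
    (hε : 0 < ε) :
    ∃ F' : Bool → C(I × I, X), (∀ s z, dist (F' s z) (F s z) < ε) ∧
      ∀ s t, ∀ z ∈ gridSet M, ∀ w ∈ gridSet M, (s ≠ t ∨ 2 / (M : ℝ) < dist z w) →
        F' s z ≠ F' t w := by
  classical
  let G : C(Bool × (I × I), X) := ⟨fun p => F p.1 p.2, continuous_prod_of_discrete_left.2
    fun s => (F s).continuous⟩
  let φ : Bool × (Bool × Fin M × Fin (M + 1)) → C(I, Bool × (I × I)) := fun e =>
    ⟨fun u => (e.1, gridEdge M e.2 u), by fun_prop⟩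
  let ψ : Bool × (Bool × Fin M × Fin (M + 1)) → C(Bool × (I × I), I) := fun e =>
    ⟨fun z => gridEdgeInv M e.2 z.2, by fun_prop⟩
  obtain ⟨G', hG', hd⟩ := H.exists_approx_forall_disjoint hI φ ψ
    (fun e u => by simp [φ, ψ, gridEdgeInv_gridEdge])
    (Finset.univ.filter fun p => Disjoint (Set.range (φ p.1)) (Set.range (φ p.2)))
    (fun p hp => (Finset.mem_filter.1 hp).2) G hε
  refine ⟨fun s => ⟨fun z => G' (s, z), by fun_prop⟩, fun s z => hG' (s, z), ?_⟩
  rintro s t z hz w hw h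
  obtain ⟨e, u, rfl⟩ := exists_gridEdge hM hz
  obtain ⟨e', u', rfl⟩ := exists_gridEdge hM hw
  refine hd ((s, e), (t, e')) (Finset.mem_filter.2 ⟨Finset.mem_univ _, ?_⟩) u u'
  rw [Set.disjoint_left]
  rintro _ ⟨v, rfl⟩ ⟨v', hv⟩
  obtain ⟨h1, h2⟩ := Prod.ext_iff.1 hv
  rcases h with h | h
  · exact h h1.symm
  · refine h.not_ge ?_
    have a1 := dist_gridEdge_le e u v
    have a2 := dist_gridEdge_le e' v' u'
    change gridEdge M e' v' = gridEdge M e v at h2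
    rw [h2] at a2
    have := dist_triangle (gridEdge M e u) (gridEdge M e v) (gridEdge M e' u')
    have e2 : (2 : ℝ) / M = 1 / M + 1 / M := by ring
    linarith

/-! ### Collapsing the square to form staircases -/

theorem monotone_unitClamp : Monotone unitClamp := Set.monotone_projIcc zero_le_one

/-- A map of the unit interval that collapses neighbourhoods of the points `i / M`, together with a
partition of unity subordinate to the preimages of the intervals `[i / M, (i + 1) / M]`. -/
theorem exists_interval_collapse {M : ℕ} (hM : 0 < M) :
    ∃ (κ : C(I, I)) (w : Fin M → C(I, ℝ)), (∀ i x, 0 ≤ w i x) ∧ (∀ x, ∑ i, w i x = 1) ∧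
      (∀ i x, w i x ≠ 0 → (i : ℝ) ≤ M * κ x ∧ (M : ℝ) * κ x ≤ i + 1) ∧
      ∀ x, dist (κ x) x ≤ 2 / M := by
  have hM' : (0 : ℝ) < M := by exact_mod_cast hM
  -- For `0 < n < M`, `S n` rises from 0 to 1 as `M x` runs over `[n - 1/4, n + 1/4]`. The
  -- conventions at `n = 0` and `n ≥ M` make the differences telescope to 1.
  let S : ℕ → I → ℝ := fun n x => if n = 0 then 1 else if M ≤ n then 0 else
    (unitClamp (2 * (M * x - n) + 1 / 2) : ℝ)
  have hSc : ∀ n, Continuous (S n) := fun n => by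
    by_cases h0 : n = 0
    · simp only [S, h0, if_true]; fun_prop
    · by_cases h1 : M ≤ n
      · simp only [S, h0, h1, if_true, if_false]; fun_prop
      · simp only [S, h0, h1, if_false]; fun_prop
  have hanti : ∀ n x, S (n + 1) x ≤ S n x := by
    intro n x
    by_cases h0 : n = 0
    · simp only [S, h0, if_true]
      split_ifs <;> first | omega | exact le_rfl | exact zero_le_one | exact (unitClamp _).2.2
    · by_cases h1 : M ≤ n + 1
      · simp only [S, h0, h1, Nat.succ_ne_zero, if_true, if_false]
        split_ifs
        · exact le_rfl
        · exact (unitClamp _).2.1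
      · have h2 : ¬ M ≤ n := by omega
        simp only [S, h0, h1, h2, Nat.succ_ne_zero, if_false]
        refine monotone_unitClamp ?_
        push_cast
        linarith
  -- `s n` rises on `[n + 1/4, n + 3/4]`, so `κ` rests at grid points exactly while the weights
  -- change.
  let s : ℕ → I → ℝ := fun n x => (unitClamp (2 * (M * x - n) - 1 / 2) : ℝ)
  let κ : C(I, I) := ⟨fun x => unitClamp ((∑ n ∈ Finset.range M, s n x) / M), by fun_prop⟩
  have hκ : ∀ x, (M : ℝ) * κ x = ∑ n ∈ Finset.range M, s n x := by
    intro x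
    change (M : ℝ) * (unitClamp _ : ℝ) = _
    rw [coe_unitClamp_of_mem, mul_div_cancel₀ _ hM'.ne']
    · exact div_nonneg (Finset.sum_nonneg fun n _ => (unitClamp _).2.1) hM'.le
    · rw [div_le_one hM']
      calc ∑ n ∈ Finset.range M, s n x ≤ ∑ n ∈ Finset.range M, (1 : ℝ) :=
            Finset.sum_le_sum fun n _ => (unitClamp _).2.2
        _ = M := by simp
  let w : Fin M → C(I, ℝ) := fun i => ⟨fun x => S i x - S (i + 1) x, (hSc _).sub (hSc _)⟩
  have hw : ∀ (i : Fin M) (x : I), w i x ≠ 0 →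
      (i : ℝ) - 1 / 4 ≤ M * x ∧ (M : ℝ) * x ≤ i + 5 / 4 := by
    intro i x h
    have hx0 : 0 ≤ (M : ℝ) * x := mul_nonneg hM'.le x.2.1
    have hx1 : (M : ℝ) * x ≤ M := mul_le_of_le_one_right hM'.le x.2.2
    have hlt : S (i + 1) x < S i x := (hanti i x).lt_of_ne fun e => h (sub_eq_zero.2 e.symm)
    have hp : ¬ M ≤ (i : ℕ) := by omega
    constructor
    · by_cases h0 : (i : ℕ) = 0
      · rw [h0]; push_cast; linarith
      · by_contra! hc
        have e1 : S i x = 0 := by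
          simp only [S, h0, hp, if_false]
          rw [unitClamp_eq_zero (by linarith)]; rfl
        have e2 : 0 ≤ S (i + 1) x := by
          simp only [S, Nat.succ_ne_zero, if_false]
          split_ifs
          · exact le_rfl
          · exact (unitClamp _).2.1
        linarith
    · by_cases h1 : M ≤ (i : ℕ) + 1
      · have : (M : ℝ) ≤ (i : ℝ) + 1 := by exact_mod_cast h1
        linarith
      · by_contra! hc
        have e1 : S (i + 1) x = 1 := by
          simp only [S, Nat.succ_ne_zero, h1, if_false]
          rw [unitClamp_eq_one (by push_cast; linarith)]; rfl
        have e2 : S i x ≤ 1 := by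
          simp only [S, hp, if_false]
          split_ifs
          · exact le_rfl
          · exact (unitClamp _).2.2
        linarith
  have hmem : ∀ (i : Fin M) (x : I), w i x ≠ 0 → (i : ℝ) ≤ M * κ x ∧ (M : ℝ) * κ x ≤ i + 1 := by
    intro i x h
    obtain ⟨h1, h2⟩ := hw i x h
    rw [hκ]
    constructor
    · calc (i : ℝ) = ∑ n ∈ Finset.range i, (1 : ℝ) := by simp
        _ ≤ ∑ n ∈ Finset.range i, s n x := by
            refine Finset.sum_le_sum fun n hn => ?_
            have : (n : ℝ) + 1 ≤ (i : ℝ) := by exact_mod_cast Finset.mem_range.1 hn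
            simp only [s]
            rw [unitClamp_eq_one (by linarith)]; rfl
        _ ≤ ∑ n ∈ Finset.range M, s n x :=
            Finset.sum_le_sum_of_subset_of_nonneg
              (Finset.range_subset_range.2 i.2.le) fun n _ _ => (unitClamp _).2.1
    · have e : ∑ n ∈ Finset.range M, s n x = ∑ n ∈ Finset.range (i + 1), s n x := by
        symm
        refine Finset.sum_subset (Finset.range_subset_range.2 i.2) fun n _ hn => ?_
        have : (i : ℝ) + 1 + 1 ≤ (n : ℝ) + 1 := by
          have := Finset.mem_range.not.1 hn
          exact_mod_cast (by omega : (i : ℕ) + 1 + 1 ≤ n + 1)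
        simp only [s]
        rw [unitClamp_eq_zero (by linarith)]; rfl
      rw [e]
      calc ∑ n ∈ Finset.range (i + 1), s n x ≤ ∑ n ∈ Finset.range (i + 1), (1 : ℝ) :=
            Finset.sum_le_sum fun n _ => (unitClamp _).2.2
        _ = i + 1 := by simp
  have hsum : ∀ x, ∑ i, w i x = 1 := by
    intro x
    have e := Finset.sum_range_sub' (fun n => S n x) M
    rw [← Fin.sum_univ_eq_sum_range (fun n => S n x - S (n + 1) x)] at e
    simp only [w, ContinuousMap.coe_mk, e]
    simp [S, hM.ne']
  refine ⟨κ, w, fun i x => sub_nonneg.2 (hanti i x), hsum, hmem, fun x => ?_⟩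
  obtain ⟨i, -, hi⟩ := Finset.exists_ne_zero_of_sum_ne_zero ((hsum x).trans_ne one_ne_zero)
  obtain ⟨h1, h2⟩ := hw i x hi
  obtain ⟨h3, h4⟩ := hmem i x hi
  rw [Subtype.dist_eq, Real.dist_eq, le_div_iff₀ hM', ← abs_of_pos hM', ← abs_mul, sub_mul,
    abs_le]
  constructor <;> linarith

theorem exists_square_collapse {M : ℕ} (hM : 0 < M) :
    ∃ (π : C(I × I, I × I)) (w : Fin M × Fin M → C(I × I, ℝ)), (∀ b z, 0 ≤ w b z) ∧
      (∀ z, ∑ b, w b z = 1) ∧ (∀ b z, w b z ≠ 0 → π z ∈ closedCell M b) ∧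
      ∀ z, dist (π z) z ≤ 2 / M := by
  obtain ⟨κ, w, h0, h1, h2, h3⟩ := exists_interval_collapse hM
  refine ⟨κ.prodMap κ, fun b => ⟨fun z => w b.1 z.1 * w b.2 z.2, by fun_prop⟩,
    fun b z => mul_nonneg (h0 _ _) (h0 _ _), fun z => ?_, fun b z h => ?_, fun z => ?_⟩
  · simp only [ContinuousMap.coe_mk, Fintype.sum_prod_type, ← Finset.mul_sum, h1, mul_one]
  · have h' := mul_ne_zero_iff.1 h
    exact ⟨h2 _ _ h'.1, h2 _ _ h'.2⟩
  · exact max_le (h3 _) (h3 _)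

/-! ### Separating levels, and pushing one cell off the walls -/

/-- Finitely many real numbers can be perturbed to distinct ones. -/
theorem exists_separated_approx {C : Type*} [Finite C] (t : C → ℝ) {ε : ℝ} (hε : 0 < ε) :
    ∃ (m : C → ℝ) (ρ : ℝ), 0 < ρ ∧ (∀ c, |m c - t c| < ε) ∧ ∀ c c', c ≠ c' → 2 * ρ ≤ |m c - m c'| := by
  -- Number the elements and add `s * e c`; only the finitely many slopes `s` in `B` produce a
  -- coincidence.
  obtain ⟨n, ⟨e⟩⟩ := Finite.exists_equiv_fin C
  have hn : (0 : ℝ) < n + 1 := by positivity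
  let B : Set ℝ := Set.range fun p : C × C => (t p.2 - t p.1) / ((e p.1 : ℝ) - e p.2)
  obtain ⟨s, ⟨hs0, hs1⟩, hsB⟩ :=
    ((Set.Ioo_infinite (div_pos hε hn)).sdiff (Set.finite_range _ : B.Finite)).nonempty
  let m : C → ℝ := fun c => t c + s * e c
  have hm : Function.Injective m := by
    intro c c' h
    by_contra hne
    have hee : ((e c : ℕ) : ℝ) - (e c' : ℕ) ≠ 0 := by
      rw [sub_ne_zero]
      exact fun h => hne (e.injective (Fin.ext (by exact_mod_cast h)))
    refine hsB ⟨(c, c'), ?_⟩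
    simp only [m] at h
    simp only
    rw [div_eq_iff hee]
    linarith
  have hclose : ∀ c, |m c - t c| < ε := by
    intro c
    have h1 : ((e c : ℕ) : ℝ) < n + 1 := by
      have : ((e c : ℕ) : ℝ) < n := by exact_mod_cast (e c).2
      linarith
    have h2 : s * (n + 1) < ε := (lt_div_iff₀ hn).1 hs1
    simp only [m, add_sub_cancel_left]
    rw [abs_of_nonneg (by positivity)]
    nlinarith
  have hfin := Set.toFinite (Set.range fun p : {p : C × C // p.1 ≠ p.2} => |m p.1.1 - m p.1.2|)
  have : ∃ ρ > 0, ∀ p : {p : C × C // p.1 ≠ p.2}, ρ ≤ |m p.1.1 - m p.1.2| := by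
    rcases isEmpty_or_nonempty {p : C × C // p.1 ≠ p.2} with hE | hE
    · exact ⟨1, one_pos, fun p => hE.elim p⟩
    · obtain ⟨p, hp⟩ := Finite.exists_min fun p : {p : C × C // p.1 ≠ p.2} => |m p.1.1 - m p.1.2|
      exact ⟨_, abs_pos.2 (sub_ne_zero.2 (hm.ne p.2)), hp⟩
  obtain ⟨ρ, hρ, hle⟩ := this
  exact ⟨m, ρ / 2, half_pos hρ, hclose, fun c c' h => by linarith [hle ⟨(c, c'), h⟩]⟩

theorem exists_int_eq_mul_unitClamp {N : ℕ} (hN : 0 < N) (v : ℤ) :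
    ∃ n : ℤ, (N : ℝ) * unitClamp (v / N) = n := by
  have hN' : (0 : ℝ) < N := by exact_mod_cast hN
  rcases le_total (v : ℝ) 0 with h | h
  · exact ⟨0, by simp [unitClamp_eq_zero (div_nonpos_of_nonpos_of_nonneg h hN'.le)]⟩
  · rcases le_total (v : ℝ) N with h' | h'
    · refine ⟨v, ?_⟩
      rw [coe_unitClamp_of_mem (by positivity) ((div_le_one hN').2 h'), mul_div_cancel₀ _ hN'.ne']
    · exact ⟨N, by simp [unitClamp_eq_one ((one_le_div hN').2 h')]⟩

theorem dist_unitClamp_le (x y : ℝ) : dist (unitClamp x) (unitClamp y) ≤ |x - y| := by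
  have h := (LipschitzWith.projIcc (zero_le_one (α := ℝ))).dist_le_mul x y
  simpa [unitClamp, Real.dist_eq] using h

theorem exists_lattice_point_near {N : ℕ} (hN : 0 < N) {S : Set (I × I)}
    (hS : ∀ z ∈ S, ∀ w ∈ S, dist z w < 1 / (4 * N)) :
    ∃ v₁ v₂ : ℤ, ∀ z ∈ S, ‖(((N : ℝ) * z.1 - v₁, (N : ℝ) * z.2 - v₂) : ℝ × ℝ)‖ < 1 := by
  have hN' : (0 : ℝ) < N := by exact_mod_cast hN
  rcases S.eq_empty_or_nonempty with rfl | ⟨z₀, hz₀⟩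
  · exact ⟨0, 0, by simp⟩
  -- The vertex nearest to one point serves for all of them: after scaling by `N` the errors are at
  -- most `1/2 + 1/4 < 1`.
  refine ⟨round ((N : ℝ) * z₀.1), round ((N : ℝ) * z₀.2), fun z hz => ?_⟩
  have aux : ∀ x y : I, dist x y < 1 / (4 * N) → |(N : ℝ) * x - round ((N : ℝ) * y)| < 1 := by
    intro x y hxy
    have h1 := abs_le.1 (abs_sub_round ((N : ℝ) * y))
    rw [Subtype.dist_eq, Real.dist_eq, lt_div_iff₀ (by positivity), ← abs_of_pos
      (show (0 : ℝ) < 4 * N by positivity), ← abs_mul, abs_lt] at hxy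
    rw [abs_lt]
    constructor <;> linarith [hxy.1, hxy.2, h1.1, h1.2]
  have h := hS z hz z₀ hz₀
  rw [Prod.dist_eq, max_lt_iff] at h
  exact max_lt (aux _ _ h.1) (aux _ _ h.2)

/-- A cell of the grid of mesh `1 / M`, placed at level `l`, is made disjoint from the walls over
the grid of mesh `1 / N`. -/
theorem IsNbhdRetraction.exists_cell_displacement {X : Type u} [MetricSpace X] {E : Type v}
    [NormedAddCommGroup E] [NormedSpace ℝ E] {k : X → E} {r : E → X} (H : IsNbhdRetraction k r)
    (ha : HasDcDStar X) {M N : ℕ} (hN : 0 < N) (b : Fin M × Fin M) (a a' : C(I × I, X))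
    (hdisj : ∀ z ∈ gridSet M, ∀ w ∈ gridSet N, a z ≠ a' w)
    (hsmall : ∀ z ∈ gridSet N, ∀ w ∈ gridSet N, (∃ u ∈ closedCell M b, a u = a' z) →
      (∃ u ∈ closedCell M b, a u = a' w) → dist z w < 1 / (4 * N)) {ω : ℝ}
    (hω : ∀ z w, dist z w ≤ 2 / (N : ℝ) → dist (a' z) (a' w) ≤ ω) {ζ : ℝ} (hζ : 0 < ζ) (l : ℝ)
    {δ : ℝ} (hδ : 0 < δ) :
    ∃ (D : (I × I) × ℝ → E) (Δ : (I × I) × ℝ → ℝ) (d : I × I → E) (q : I × I → ℝ),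
      Continuous D ∧ Continuous Δ ∧ Continuous d ∧ Continuous q ∧
      (∀ z s, δ ≤ |s - l| → D (z, s) = 0 ∧ Δ (z, s) = 0) ∧
      (∀ z s, |s - l| < δ → |s + Δ (z, s) - l| < δ) ∧ (∀ z s, ‖D (z, s)‖ ≤ ω + ζ) ∧
      (∀ z ∈ gridSet N, ∀ s, ∃ z' ∈ gridSet N, dist (r (k (a' z) + D (z, s))) (a' z') < ζ) ∧
      (∀ u, u ∉ openCell M b → d u = 0 ∧ q u = 0) ∧ (∀ u, |q u| < δ) ∧ (∀ u, ‖d u‖ ≤ ζ) ∧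
      ∀ z ∈ gridSet N, ∀ s, ∀ u ∈ openCell M b, |s - l| < δ →
        r (k (a' z) + D (z, s)) = r (k (a u) + d u) → s + Δ (z, s) ≠ l + q u := by
  have hN' : (0 : ℝ) < N := by exact_mod_cast hN
  obtain ⟨v₁, v₂, hv⟩ := exists_lattice_point_near hN
    (S := {z | z ∈ gridSet N ∧ ∃ u ∈ closedCell M b, a u = a' z})
    (fun z hz w hw => hsmall z hz.1 w hw.1 hz.2 hw.2)
  -- Magnification taking the grid vertex near the cell to the origin and the mesh to 1, so that the
  -- grid within the open unit ball becomes part of the cross.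
  let sc : I × I → ℝ × ℝ := fun z => ((N : ℝ) * z.1 - v₁, (N : ℝ) * z.2 - v₂)
  have hsc : Continuous sc := by fun_prop
  let cl : ℝ × ℝ → I × I := fun x => (unitClamp ((x.1 + v₁) / N), unitClamp ((x.2 + v₂) / N))
  have hclsc : ∀ z, cl (sc z) = z := by
    intro z
    have e : ∀ (x : I) (v : ℝ), unitClamp (((N : ℝ) * x - v + v) / N) = x := fun x v => by
      rw [sub_add_cancel, mul_div_cancel_left₀ _ hN'.ne', unitClamp_coe]
    exact Prod.ext (e _ _) (e _ _)
  -- Clamping keeps the image in the grid even where a leg of the cross leaves the square, so the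
  -- full cross can always be used.
  have hclc : ∀ x ∈ planeCross, cl x ∈ gridSet N := by
    rintro ⟨x, y⟩ ⟨h, -⟩
    rcases mul_eq_zero.1 h with h | h <;> simp only at h <;> subst h
    · left
      simpa [cl] using exists_int_eq_mul_unitClamp hN v₁
    · right
      simpa [cl] using exists_int_eq_mul_unitClamp hN v₂
  have hclA : ∀ x ∈ sc '' gridSet N ∪ planeCross, cl x ∈ gridSet N := by
    rintro x (⟨z, hz, rfl⟩ | hx)
    · rwa [hclsc]
    · exact hclc x hx
  let γ : C(ℝ × ℝ, X) := ⟨fun x => a' (cl x), by fun_prop⟩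
  have hγsc : ∀ z, γ (sc z) = a' z := fun z => congrArg a' (hclsc z)
  let Φ : C(I × I, I × I) := (cellMap M b.1).prodMap (cellMap M b.2)
  have hΦ : ∀ u, Φ u ∈ closedCell M b := by
    intro u
    have h1 := mul_cellMap b.1.2 u.1
    have h2 := mul_cellMap b.2.2 u.2
    refine ⟨?_, ?_⟩
    · change _ ≤ (M : ℝ) * cellMap M b.1 u.1 ∧ (M : ℝ) * cellMap M b.1 u.1 ≤ _
      rw [h1]
      exact ⟨by linarith [u.1.2.1], by linarith [u.1.2.2]⟩
    · change _ ≤ (M : ℝ) * cellMap M b.2 u.2 ∧ (M : ℝ) * cellMap M b.2 u.2 ≤ _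
      rw [h2]
      exact ⟨by linarith [u.2.2.1], by linarith [u.2.2.2]⟩
  have hΦb : ∀ u ∈ squareBoundary, Φ u ∈ gridSet M := by
    rintro ⟨u, w⟩ hu
    have h1 := mul_cellMap b.1.2 u
    have h2 := mul_cellMap b.2.2 w
    rcases hu with h | h | h | h <;> simp only at h <;> subst h
    · exact Or.inl ⟨(b.1 : ℕ), h1.trans (by simp)⟩
    · exact Or.inl ⟨(b.1 : ℕ) + 1, h1.trans (by simp)⟩
    · exact Or.inr ⟨(b.2 : ℕ), h2.trans (by simp)⟩
    · exact Or.inr ⟨(b.2 : ℕ) + 1, h2.trans (by simp)⟩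
  let Ψ : C(I × I, I × I) := (cellInv M b.1).prodMap (cellInv M b.2)
  have hΨ : ∀ u ∈ openCell M b, Φ (Ψ u) = u := fun u hu =>
    Prod.ext (cellMap_cellInv b.1.2 hu.1.1.le hu.1.2.le) (cellMap_cellInv b.2.2 hu.2.1.le hu.2.2.le)
  have hΨb : ∀ u, u ∉ openCell M b → Ψ u ∈ squareBoundary := by
    intro u hu
    rcases not_and_or.1 hu with h | h
    · rcases cellInv_eq_zero_or_one h with h | h
      · exact Or.inl h
      · exact Or.inr (Or.inl h)
    · rcases cellInv_eq_zero_or_one h with h | h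
      · exact Or.inr (Or.inr (Or.inl h))
      · exact Or.inr (Or.inr (Or.inr h))
  obtain ⟨D, Δ, d, q, hD, hΔ, hd, hq, e1, e2, e3, e4, e5, e6, e7, e8⟩ :=
    H.exists_cross_displacement ha γ (a.comp Φ) ((isCompact_gridSet N).image hsc)
      (by
        rintro _ ⟨z, hz, rfl⟩ hz1
        refine ⟨?_, hz1.le⟩
        have aux : ∀ (x : ℝ) (v n : ℤ), x = n → |x - v| < 1 → x - v = 0 := by
          rintro x v n rfl h
          have : |n - v| < 1 := by exact_mod_cast h
          rw [Int.abs_lt_one_iff] at this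
          exact_mod_cast this
        have h1 := (norm_fst_le (sc z)).trans_lt hz1
        have h2 := (norm_snd_le (sc z)).trans_lt hz1
        rcases hz with ⟨n, hn⟩ | ⟨n, hn⟩
        · exact mul_eq_zero_of_left (aux _ _ n hn h1) _
        · exact mul_eq_zero_of_right _ (aux _ _ n hn h2))
      (fun u hu x hx => hdisj _ (hΦb u hu) _ (hclA x hx))
      (by
        rintro _ ⟨z, hz, rfl⟩ hz1 u he
        rw [hγsc] at he
        exact (hv z ⟨hz, Φ u, hΦ u, he⟩).not_ge hz1)
      (ω := ω) (by
        intro x hx y hy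
        refine hω _ _ ?_
        have aux : ∀ s t v : ℝ, |s| ≤ 1 → |t| ≤ 1 →
            dist (unitClamp ((s + v) / N)) (unitClamp ((t + v) / N)) ≤ 2 / N := by
          intro s t v hs ht
          refine (dist_unitClamp_le _ _).trans ?_
          rw [← sub_div, abs_div, abs_of_pos hN']
          gcongr
          rw [abs_le] at hs ht ⊢
          constructor <;> linarith [hs.1, hs.2, ht.1, ht.2]
        exact max_le (aux _ _ _ ((norm_fst_le x).trans hx.2) ((norm_fst_le y).trans hy.2))
          (aux _ _ _ ((norm_snd_le x).trans hx.2) ((norm_snd_le y).trans hy.2)))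
      hζ
  have habs : ∀ x : ℝ, |x / δ| = |x| / δ := fun x => by rw [abs_div, abs_of_pos hδ]
  -- The normalized level interval `(-1, 1)` is rescaled to radius `δ` around `l`.
  refine ⟨fun p => D (sc p.1, (p.2 - l) / δ), fun p => δ * Δ (sc p.1, (p.2 - l) / δ),
    fun z => d (Ψ z), fun z => δ * q (Ψ z), by fun_prop, by fun_prop, by fun_prop, by fun_prop,
    ?_, ?_, ?_, ?_, ?_, ?_, ?_, ?_⟩
  · intro z s hs
    have := e1 (sc z) ((s - l) / δ) (Or.inr (by rwa [habs, one_le_div hδ]))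
    simp [this]
  · intro z s hs
    have := e2 (sc z) ((s - l) / δ) (by rwa [habs, div_lt_one hδ])
    have e : s + δ * Δ (sc z, (s - l) / δ) - l = δ * ((s - l) / δ + Δ (sc z, (s - l) / δ)) := by
      rw [mul_add, mul_div_cancel₀ _ hδ.ne']; ring
    simp only [e]
    rw [abs_mul, abs_of_pos hδ]
    exact mul_lt_of_lt_one_right hδ this
  · exact fun z s => e3 _ _
  · intro z hz s
    obtain ⟨x, hx, hlt⟩ := e4 (sc z) ⟨z, hz, rfl⟩ ((s - l) / δ)
    rw [hγsc] at hlt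
    exact ⟨cl x, hclA x hx, hlt⟩
  · intro u hu
    simp [e5 _ (hΨb u hu)]
  · intro u
    rw [abs_mul, abs_of_pos hδ]
    exact mul_lt_of_lt_one_right hδ (e6 _)
  · exact fun u => e7 _
  · intro z hz s u hu hs heq hlev
    refine e8 (sc z) ⟨z, hz, rfl⟩ ((s - l) / δ) (Ψ u) (by rwa [habs, div_lt_one hδ]) ?_ ?_
    · rw [hγsc, ContinuousMap.comp_apply, hΨ u hu]
      exact heq
    · have : δ * ((s - l) / δ + Δ (sc z, (s - l) / δ)) = δ * q (Ψ u) := by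
        rw [mul_add, mul_div_cancel₀ _ hδ.ne']
        simp only at hlev
        linarith
      exact mul_left_cancel₀ hδ.ne' this

/-! ### Making two staircases disjoint -/

theorem lt_two_mul_of_abs_sub_lt {x y l δ : ℝ} (h : |x - l| < δ) (h' : |y - l| < δ) :
    |x - y| < 2 * δ := by
  rw [abs_lt] at *
  constructor <;> linarith [h.1, h.2, h'.1, h'.2]

/-- Staircase maps, with spatial parts `a s ∘ π` and levels `∑ b, w b * l (s, b)`, are made disjoint
by displacements of the cells of each of them and of the walls of the other one. -/
theorem IsNbhdRetraction.exists_disjoint_staircases {X : Type u} [MetricSpace X] {E : Type v}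
    [NormedAddCommGroup E] [NormedSpace ℝ E] {k : X → E} {r : E → X} (H : IsNbhdRetraction k r)
    (ha : HasDcDStar X) {M N : ℕ} (hM : 0 < M) (hN : 0 < N) (hNM : gridSet N ⊆ gridSet M)
    (a : Bool → C(I × I, X))
    (hdisj : ∀ s, ∀ z ∈ gridSet M, ∀ w ∈ gridSet M, a s z ≠ a (!s) w)
    (hsmall : ∀ s b, ∀ z ∈ gridSet N, ∀ w ∈ gridSet N, (∃ u ∈ closedCell M b, a s u = a (!s) z) →
      (∃ u ∈ closedCell M b, a s u = a (!s) w) → dist z w < 1 / (4 * N)) {ω : ℝ} (hω0 : 0 ≤ ω)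
    (hω : ∀ s z w, dist z w ≤ 2 / (N : ℝ) → dist (a s z) (a s w) ≤ ω) {ζ : ℝ} (hζ : 0 < ζ)
    (π : C(I × I, I × I)) (w : Fin M × Fin M → C(I × I, ℝ)) (hw1 : ∀ z, ∑ b, w b z = 1)
    (hw : ∀ b z, w b z ≠ 0 → π z ∈ closedCell M b) (l : Bool × (Fin M × Fin M) → ℝ) {δ : ℝ}
    (hδ : 0 < δ) (hl : ∀ β β', β ≠ β' → 2 * δ ≤ |l β - l β'|)
    (hΓ : ∀ s z b, |∑ c, w c z * l (s, c) - l (!s, b)| < δ → π z ∈ gridSet N) :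
    ∃ (g : Bool → I × I → E) (L : Bool → I × I → ℝ), (∀ s, Continuous (g s)) ∧
      (∀ s, Continuous (L s)) ∧ (∀ s z, ‖g s z - k (a s (π z))‖ ≤ ω + ζ) ∧
      (∀ s z, |L s z - ∑ c, w c z * l (s, c)| < 2 * δ) ∧
      ∀ z z', r (g true z) = r (g false z') → L true z ≠ L false z' := by
  classical
  -- separation of the grids
  obtain ⟨η, hη, hsep⟩ : ∃ η > 0, ∀ s, ∀ z ∈ gridSet M, ∀ w ∈ gridSet M,
      η ≤ dist (a s z) (a (!s) w) := by
    obtain ⟨η, hη, h⟩ := ((isCompact_gridSet M).image (a true).continuous).exists_pos_le_dist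
      ((isCompact_gridSet M).image (a false).continuous) (by
        rw [Set.disjoint_left]
        rintro _ ⟨z, hz, rfl⟩ ⟨w, hw, he⟩
        exact hdisj true z hz w hw he.symm)
    refine ⟨η, hη, fun s z hz w hw => ?_⟩
    cases s
    · rw [dist_comm]; exact h _ ⟨w, hw, rfl⟩ _ ⟨z, hz, rfl⟩
    · exact h _ ⟨z, hz, rfl⟩ _ ⟨w, hw, rfl⟩
  have hζ' : 0 < min ζ η := lt_min hζ hη
  have hcell := fun β : Bool × (Fin M × Fin M) =>
    H.exists_cell_displacement ha hN β.2 (a β.1) (a (!β.1))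
      (fun z hz w hw => hdisj β.1 z hz w (hNM hw)) (hsmall β.1 β.2) (hω (!β.1)) hζ' (l β) hδ
  choose D Δ d q hD hΔ hd hq e1 e2 e3 e4 e5 e6 e7 e8 using hcell
  let lam : Bool → I × I → ℝ := fun s z => ∑ c, w c z * l (s, c)
  have hlamc : ∀ s, Continuous (lam s) := fun s => by fun_prop
  -- A point receives the push of its own cell and the push of its wall away from cells of the other
  -- staircase. At most one spatial summand is nonzero: cell pushes vanish over the grid, and the
  -- level intervals of wall pushes are disjoint.
  let g : Bool → I × I → E := fun s z =>
    k (a s (π z)) + (∑ b, d (s, b) (π z) + ∑ b, D (!s, b) (π z, lam s z))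
  let L : Bool → I × I → ℝ := fun s z =>
    lam s z + (∑ b, q (s, b) (π z) + ∑ b, Δ (!s, b) (π z, lam s z))
  have hk := H.continuous_left
  have hwall : ∀ s z, π z ∈ gridSet M → ∑ b, d (s, b) (π z) = 0 ∧ ∑ b, q (s, b) (π z) = 0 :=
    fun s z hz => ⟨Finset.sum_eq_zero fun b _ => (e5 _ _ (notMem_openCell_of_mem_gridSet hz b)).1,
      Finset.sum_eq_zero fun b _ => (e5 _ _ (notMem_openCell_of_mem_gridSet hz b)).2⟩
  have hopen : ∀ s z b, π z ∈ openCell M b → ∑ b, d (s, b) (π z) = d (s, b) (π z) ∧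
      ∑ b, q (s, b) (π z) = q (s, b) (π z) ∧ lam s z = l (s, b) := by
    intro s z b hb
    have hout : ∀ c, c ≠ b → π z ∉ openCell M c := fun c hc hcz =>
      hc (eq_of_mem_openCell_of_mem_closedCell hb (openCell_subset_closedCell _ _ hcz))
    refine ⟨Fintype.sum_eq_single b fun c hc => (e5 _ _ (hout c hc)).1,
      Fintype.sum_eq_single b fun c hc => (e5 _ _ (hout c hc)).2, ?_⟩
    have h0 : ∀ c, c ≠ b → w c z = 0 := fun c hc => by
      by_contra h
      exact hc (eq_of_mem_openCell_of_mem_closedCell hb (hw c z h))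
    have h1 := hw1 z
    rw [Fintype.sum_eq_single b h0] at h1
    simp only [lam]
    rw [Fintype.sum_eq_single b fun c hc => by rw [h0 c hc, zero_mul], h1, one_mul]
  -- Besides the size bounds, a trichotomy by the new level: near a cell level of the other
  -- staircase (a wall over the coarse grid), near a cell level of the same staircase, or near none
  -- (an unmoved grid point).
  have tri : ∀ s z, (‖g s z - k (a s (π z))‖ ≤ ω + ζ ∧ |L s z - lam s z| < 2 * δ) ∧
      ((∃ b, |L s z - l (!s, b)| < δ ∧ |lam s z - l (!s, b)| < δ ∧ π z ∈ gridSet N ∧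
          g s z = k (a s (π z)) + D (!s, b) (π z, lam s z) ∧
          L s z = lam s z + Δ (!s, b) (π z, lam s z)) ∨
        (∃ b, |L s z - l (s, b)| < δ ∧ ((π z ∈ openCell M b ∧
          g s z = k (a s (π z)) + d (s, b) (π z) ∧ L s z = l (s, b) + q (s, b) (π z)) ∨
          (π z ∈ gridSet M ∧ g s z = k (a s (π z))))) ∨
        ((∀ β, δ ≤ |L s z - l β|) ∧ π z ∈ gridSet M ∧ g s z = k (a s (π z)))) := by
    intro s z
    by_cases hA : ∃ b, |lam s z - l (!s, b)| < δ
    · obtain ⟨b, hb⟩ := hA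
      have hz := hΓ s z b hb
      obtain ⟨w1, w2⟩ := hwall s z (hNM hz)
      have hfar : ∀ c, c ≠ b → δ ≤ |lam s z - l (!s, c)| := fun c hc => by
        by_contra! hlt
        have h1 := hl (!s, c) (!s, b) (by simpa using hc)
        have h2 := lt_two_mul_of_abs_sub_lt (abs_sub_comm (lam s z) _ ▸ hlt)
          (abs_sub_comm (lam s z) _ ▸ hb)
        linarith
      have hg : g s z = k (a s (π z)) + D (!s, b) (π z, lam s z) := by
        simp only [g, w1, zero_add]
        rw [Fintype.sum_eq_single b fun c hc => (e1 (!s, c) _ _ (hfar c hc)).1]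
      have hL : L s z = lam s z + Δ (!s, b) (π z, lam s z) := by
        simp only [L, w2, zero_add]
        rw [Fintype.sum_eq_single b fun c hc => (e1 (!s, c) _ _ (hfar c hc)).2]
      have hLb : |L s z - l (!s, b)| < δ := by rw [hL]; exact e2 (!s, b) _ _ hb
      refine ⟨⟨?_, lt_two_mul_of_abs_sub_lt hLb hb⟩, Or.inl ⟨b, hLb, hb, hz, hg, hL⟩⟩
      rw [hg, add_sub_cancel_left]
      exact (e3 (!s, b) _ _).trans (by linarith [min_le_left ζ η])
    · push Not at hA
      have s1 : ∑ b, D (!s, b) (π z, lam s z) = 0 :=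
        Finset.sum_eq_zero fun b _ => (e1 (!s, b) _ _ (hA b)).1
      have s2 : ∑ b, Δ (!s, b) (π z, lam s z) = 0 :=
        Finset.sum_eq_zero fun b _ => (e1 (!s, b) _ _ (hA b)).2
      by_cases hz : π z ∈ gridSet M
      · obtain ⟨w1, w2⟩ := hwall s z hz
        have hg : g s z = k (a s (π z)) := by simp [g, w1, s1]
        have hL : L s z = lam s z := by simp [L, w2, s2]
        refine ⟨⟨?_, ?_⟩, Or.inr ?_⟩
        · rw [hg, sub_self, norm_zero]; positivity
        · rw [hL, sub_self, abs_zero]; positivity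
        · by_cases hB : ∃ b, |lam s z - l (s, b)| < δ
          · obtain ⟨b, hb⟩ := hB
            exact Or.inl ⟨b, hL ▸ hb, Or.inr ⟨hz, hg⟩⟩
          · push Not at hB
            refine Or.inr ⟨?_, hz, hg⟩
            rintro ⟨t, b⟩
            rw [hL]
            rcases Bool.eq_or_eq_not t s with rfl | rfl
            · exact hB b
            · exact hA b
      · obtain ⟨b, hb⟩ := exists_mem_openCell hM hz
        obtain ⟨w1, w2, w3⟩ := hopen s z b hb
        have hg : g s z = k (a s (π z)) + d (s, b) (π z) := by simp only [g, w1, s1, add_zero]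
        have hL : L s z = l (s, b) + q (s, b) (π z) := by
          simp only [L, w2, s2, add_zero]; rw [w3]
        have hLb : |L s z - l (s, b)| < δ := by
          rw [hL, add_sub_cancel_left]; exact e6 _ _
        refine ⟨⟨?_, ?_⟩, Or.inr (Or.inl ⟨b, hLb, Or.inl ⟨hb, hg, hL⟩⟩)⟩
        · rw [hg, add_sub_cancel_left]
          exact (e7 _ _).trans (by linarith [min_le_left ζ η])
        · rw [w3]; linarith
  have hBA : ∀ s z z' b b', L s z = L (!s) z' → r (g s z) = r (g (!s) z') →
      |L s z - l (s, b)| < δ → ((π z ∈ openCell M b ∧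
          g s z = k (a s (π z)) + d (s, b) (π z) ∧ L s z = l (s, b) + q (s, b) (π z)) ∨
          (π z ∈ gridSet M ∧ g s z = k (a s (π z)))) →
      |L (!s) z' - l (s, b')| < δ → |lam (!s) z' - l (s, b')| < δ → π z' ∈ gridSet N →
      g (!s) z' = k (a (!s) (π z')) + D (s, b') (π z', lam (!s) z') →
      L (!s) z' = lam (!s) z' + Δ (s, b') (π z', lam (!s) z') → False := by
    intro s z z' b b' hLL hgg hb hz hb' hlam hz' hg' hL'
    obtain rfl : b' = b := by
      by_contra hne
      have h1 := hl (s, b') (s, b) (by simpa using hne)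
      rw [← hLL] at hb'
      rw [abs_sub_comm] at hb hb'
      linarith [lt_two_mul_of_abs_sub_lt hb' hb]
    rcases hz with ⟨hz, hg, hL⟩ | ⟨hz, hg⟩
    · refine e8 (s, b') (π z') hz' (lam (!s) z') (π z) hz hlam ?_ ?_
      · rw [← hg, ← hg', hgg]
      · rw [← hL', ← hL, hLL]
    -- Over the grid the point of the first staircase is unmoved; the pushed wall stays within `η`
    -- of the image of its own grid, and the images of the two grids are `η` apart.
    · obtain ⟨y, hy, hlt⟩ := e4 (s, b') (π z') hz' (lam (!s) z')
      have h1 : r (k (a (!s) (π z')) + D (s, b') (π z', lam (!s) z')) = a s (π z) := by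
        rw [← hg', ← hgg, hg, H.leftInv]
      simp only [h1] at hlt
      linarith [hsep s _ hz _ (hNM hy), min_le_right ζ η]
  refine ⟨g, L, fun s => by fun_prop, fun s => by fun_prop, fun s z => (tri s z).1.1,
    fun s z => (tri s z).1.2, fun z z' hgg hLL => ?_⟩
  rcases (tri true z).2 with ⟨b, h1, h2, h3, h4, h5⟩ | ⟨b, h1, h2⟩ | ⟨h1, h2, h3⟩
  · rcases (tri false z').2 with ⟨b', h1', h2', h3', h4', h5'⟩ | ⟨b', h1', h2'⟩ | ⟨h1', h2', h3'⟩
    · have := hl (!true, b) (!false, b') (by simp)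
      rw [hLL, abs_sub_comm] at h1
      rw [abs_sub_comm] at h1'
      linarith [lt_two_mul_of_abs_sub_lt h1 h1']
    · exact hBA false z' z b' b hLL.symm hgg.symm h1' h2' h1 h2 h3 h4 h5
    · exact (h1' (!true, b)).not_gt (hLL ▸ h1)
  · rcases (tri false z').2 with ⟨b', h1', h2', h3', h4', h5'⟩ | ⟨b', h1', h2'⟩ | ⟨h1', h2', h3'⟩
    · exact hBA true z z' b b' hLL hgg h1 h2 h1' h2' h3' h4' h5'
    · have := hl (true, b) (false, b') (by simp)
      rw [hLL, abs_sub_comm] at h1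
      rw [abs_sub_comm] at h1'
      linarith [lt_two_mul_of_abs_sub_lt h1 h1']
    · exact (h1' (true, b)).not_gt (hLL ▸ h1)
  · rcases (tri false z').2 with ⟨b', h1', -⟩ | ⟨b', h1', -⟩ | ⟨-, h2', h3'⟩
    · exact (h1 (!false, b')).not_gt (hLL ▸ h1')
    · exact (h1 (false, b')).not_gt (hLL ▸ h1')
    · rw [h3, h3', H.leftInv, H.leftInv] at hgg
      exact hdisj true _ h2 _ h2' hgg

/-! ### The DTP* for a constant arc gives the DDP of `X × ℝ` -/

theorem gridSet_subset_mul (N L : ℕ) : gridSet N ⊆ gridSet (N * L) := by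
  rintro z (⟨n, hn⟩ | ⟨n, hn⟩)
  · exact Or.inl ⟨n * L, by push_cast; rw [← hn]; ring⟩
  · exact Or.inr ⟨n * L, by push_cast; rw [← hn]; ring⟩

theorem closedCell_subset_divNat {N L : ℕ} (hL : 0 < L) (b : Fin (N * L) × Fin (N * L)) :
    closedCell (N * L) b ⊆ closedCell N (b.1.divNat, b.2.divNat) := by
  have aux : ∀ (i : Fin (N * L)) (x : ℝ), (i : ℝ) ≤ (N * L : ℕ) * x → (N * L : ℕ) * x ≤ i + 1 →
      (i.divNat : ℝ) ≤ N * x ∧ N * x ≤ (i.divNat : ℝ) + 1 := by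
    intro i x h1 h2
    have hL' : (0 : ℝ) < L := by exact_mod_cast hL
    have e1 : ((i : ℕ) / L : ℕ) * (L : ℝ) ≤ (i : ℕ) := by
      exact_mod_cast Nat.div_mul_le_self i L
    have e2 : ((i : ℕ) : ℝ) + 1 ≤ (((i : ℕ) / L : ℕ) + 1) * (L : ℝ) := by
      exact_mod_cast Nat.lt_div_mul_add hL |>.trans_eq (by ring : (i : ℕ) / L * L + L = _)
    rw [Fin.coe_divNat]
    push_cast at h1 h2
    constructor
    · exact le_of_mul_le_mul_right (by linarith) hL'
    · exact le_of_mul_le_mul_right (by linarith) hL'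
  exact fun z h => ⟨aux _ _ h.1.1 h.1.2, aux _ _ h.2.1 h.2.2⟩

theorem dist_le_of_mem_closedCell {M : ℕ} {b : Fin M × Fin M} {z w : I × I}
    (hz : z ∈ closedCell M b) (hw : w ∈ closedCell M b) : dist z w ≤ 1 / M := by
  have hM : (0 : ℝ) < M := by exact_mod_cast (Nat.zero_le _).trans_lt b.1.2
  have aux : ∀ (x y : I) (i : ℝ), i ≤ M * x → (M : ℝ) * x ≤ i + 1 → i ≤ M * y →
      (M : ℝ) * y ≤ i + 1 → dist x y ≤ 1 / M := by
    intro x y i h1 h2 h3 h4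
    rw [Subtype.dist_eq, Real.dist_eq, le_div_iff₀ hM, ← abs_of_pos hM, ← abs_mul, abs_le]
    constructor <;> linarith
  exact max_le (aux _ _ _ hz.1.1 hz.1.2 hw.1.1 hw.1.2) (aux _ _ _ hz.2.1 hz.2.2 hw.2.1 hw.2.2)

theorem corner_mem_closedCell {N : ℕ} (b : Fin N × Fin N) :
    (cellMap N b.1 0, cellMap N b.2 0) ∈ closedCell N b := by
  simp [closedCell, mul_cellMap b.1.2, mul_cellMap b.2.2]

theorem abs_sum_mul_sub_le {ι : Type*} [Fintype ι] (w l : ι → ℝ) (h0 : ∀ i, 0 ≤ w i)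
    (h1 : ∑ i, w i = 1) {x B : ℝ} (h : ∀ i, w i ≠ 0 → |l i - x| ≤ B) :
    |∑ i, w i * l i - x| ≤ B := by
  have e : ∑ i, w i * l i - x = ∑ i, w i * (l i - x) := by
    simp only [mul_sub, Finset.sum_sub_distrib, ← Finset.sum_mul, h1, one_mul]
  rw [e]
  calc |∑ i, w i * (l i - x)| ≤ ∑ i, |w i * (l i - x)| := Finset.abs_sum_le_sum_abs _ _
    _ ≤ ∑ i, w i * B := by
        refine Finset.sum_le_sum fun i _ => ?_
        rw [abs_mul, abs_of_nonneg (h0 i)]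
        by_cases hi : w i = 0
        · simp [hi]
        · exact mul_le_mul_of_nonneg_left (h i hi) (h0 i)
    _ = B := by rw [← Finset.sum_mul, h1, one_mul]

theorem exists_uniform_delta {Z Y : Type*} [MetricSpace Z] [CompactSpace Z] [MetricSpace Y]
    (f : Bool → C(Z, Y)) {ε : ℝ} (hε : 0 < ε) :
    ∃ δ > 0, ∀ s z w, dist z w < δ → dist (f s z) (f s w) < ε := by
  have h : ∀ s, ∃ δ > 0, ∀ z w, dist z w < δ → dist (f s z) (f s w) < ε := fun s => by
    obtain ⟨δ, hδ, h⟩ := Metric.uniformContinuous_iff.1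
      (CompactSpace.uniformContinuous_of_continuous (f s).continuous) ε hε
    exact ⟨δ, hδ, fun z w => @h z w⟩
  choose δ hδ h using h
  refine ⟨min (δ true) (δ false), lt_min (hδ _) (hδ _), fun s z w hzw => h s z w ?_⟩
  cases s
  · exact hzw.trans_le (min_le_right _ _)
  · exact hzw.trans_le (min_le_left _ _)

/-- Levels for the cells of two grids of mesh `1 / (N * L)`: they are distinct, and cells that lie
in different cells of the coarser grids have far apart levels. -/
theorem exists_cell_levels {N L : ℕ} (t : Bool × (Fin N × Fin N) → ℝ) {ε : ℝ} (hε : 0 < ε) :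
    ∃ (m : Bool × (Fin N × Fin N) → ℝ) (l : Bool × (Fin (N * L) × Fin (N * L)) → ℝ) (δ ρ : ℝ),
      0 < δ ∧ δ ≤ ε ∧ δ ≤ ρ / 2 ∧ (∀ β, |m β - t β| < ε) ∧
      (∀ β β', β ≠ β' → 2 * ρ ≤ |m β - m β'|) ∧ (∀ β β', β ≠ β' → 2 * δ ≤ |l β - l β'|) ∧
      (∀ s b, |l (s, b) - m (s, b.1.divNat, b.2.divNat)| < ρ / 2) ∧
      ∀ s b, |l (s, b) - m (s, b.1.divNat, b.2.divNat)| < ε := by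
  obtain ⟨m, ρ, hρ, hm, hm'⟩ := exists_separated_approx t hε
  obtain ⟨l, ρ', hρ', hl, hl'⟩ := exists_separated_approx
    (fun β : Bool × (Fin (N * L) × Fin (N * L)) => m (β.1, β.2.1.divNat, β.2.2.divNat))
    (lt_min (half_pos hρ) hε)
  refine ⟨m, l, min ρ' (min (ρ / 2) ε), ρ, lt_min hρ' (lt_min (half_pos hρ) hε),
    (min_le_right _ _).trans (min_le_right _ _), (min_le_right _ _).trans (min_le_left _ _), hm, hm',
    fun β β' h => ?_, fun s b => (hl (s, b)).trans_le (min_le_left _ _),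
    fun s b => (hl (s, b)).trans_le (min_le_right _ _)⟩
  linarith [hl' β β' h, min_le_left ρ' (min (ρ / 2) ε)]

theorem IsNbhdRetraction.approxDisjoint_prod_real {X : Type u} [MetricSpace X] {E : Type v}
    [NormedAddCommGroup E] [NormedSpace ℝ E] {k : X → E} {r : E → X} (H : IsNbhdRetraction k r)
    (hI : ApproxDisjoint X I I) (ha : HasDcDStar X) :
    ApproxDisjoint (X × ℝ) (I × I) (I × I) := by
  intro f₁ f₂ ε hε
  let f : Bool → C(I × I, X × ℝ) := fun s => cond s f₁ f₂
  let A : Bool → C(I × I, X) := fun s => ⟨fun z => (f s z).1, by fun_prop⟩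
  let c : Bool → C(I × I, ℝ) := fun s => ⟨fun z => (f s z).2, by fun_prop⟩
  obtain ⟨δ₀, hδ₀, hr⟩ : ∃ δ > 0, ∀ s, ∀ g : I × I → E, Continuous g →
      (∀ z, ‖g z - k (A s z)‖ < δ) →
      ∃ F' : C(I × I, X), (∀ z, F' z = r (g z)) ∧ ∀ z, dist (F' z) (A s z) < ε := by
    have h := fun s => H.exists_delta_map (A s) hε
    choose δ hδ h using h
    refine ⟨min (δ true) (δ false), lt_min (hδ _) (hδ _), fun s g hg hgA => h s g hg fun z => ?_⟩
    cases s
    · exact (hgA z).trans_le (min_le_right _ _)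
    · exact (hgA z).trans_le (min_le_left _ _)
  obtain ⟨τ, hτ, hA⟩ := exists_uniform_delta A (show 0 < δ₀ / 10 by positivity)
  obtain ⟨τ', hτ', hc⟩ := exists_uniform_delta c (show 0 < ε / 10 by positivity)
  -- the coarse grid
  obtain ⟨N, hN⟩ := exists_nat_gt (4 / min τ τ')
  have hττ : 0 < min τ τ' := lt_min hτ hτ'
  have hN' : (0 : ℝ) < N := (by positivity : (0 : ℝ) < 4 / min τ τ').trans hN
  have hN0 : 0 < N := by exact_mod_cast hN'
  have h4 : 4 / (N : ℝ) < min τ τ' := (div_lt_comm₀ hττ hN').1 hN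
  have h4τ : 4 / (N : ℝ) < τ := h4.trans_le (min_le_left _ _)
  have h4τ' : 4 / (N : ℝ) < τ' := h4.trans_le (min_le_right _ _)
  -- General position on mesh `1 / (16 N)` separates points more than `1 / (8 N)` apart, hence those
  -- at distance at least `1 / (4 N)`.
  obtain ⟨A₁, hA₁, hinj⟩ := H.exists_approx_grid hI (M := N * 16) (by positivity) A
    (show 0 < δ₀ / 10 by positivity)
  obtain ⟨θ, hθ, hsep⟩ : ∃ θ > 0, ∀ s, ∀ z ∈ gridSet N, ∀ w ∈ gridSet N,
      1 / (4 * (N : ℝ)) ≤ dist z w → θ ≤ dist (A₁ s z) (A₁ s w) := by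
    have h : ∀ s, ∃ θ > 0, ∀ z ∈ gridSet N, ∀ w ∈ gridSet N,
        1 / (4 * (N : ℝ)) ≤ dist z w → θ ≤ dist (A₁ s z) (A₁ s w) := by
      intro s
      have hK : IsCompact ((gridSet N ×ˢ gridSet N) ∩ {p | 1 / (4 * (N : ℝ)) ≤ dist p.1 p.2}) :=
        ((isCompact_gridSet N).prod (isCompact_gridSet N)).inter_right
          (isClosed_le continuous_const continuous_dist)
      obtain ⟨θ, hθ, h⟩ := hK.exists_forall_le' (f := fun p => dist (A₁ s p.1) (A₁ s p.2))
        (Continuous.continuousOn (by fun_prop)) (a := 0) (by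
          rintro ⟨z, w⟩ ⟨⟨hz, hw⟩, hd⟩
          refine dist_pos.2 (hinj s s z (gridSet_subset_mul _ _ hz) w (gridSet_subset_mul _ _ hw)
            (Or.inr (lt_of_lt_of_le ?_ hd)))
          push_cast
          rw [div_lt_div_iff₀ (by positivity) (by positivity)]
          linarith)
      exact ⟨θ, hθ, fun z hz w hw hd => h (z, w) ⟨⟨hz, hw⟩, hd⟩⟩
    choose θ hθ h using h
    refine ⟨min (θ true) (θ false), lt_min (hθ _) (hθ _), fun s z hz w hw hd => ?_⟩
    cases s
    · exact (min_le_right _ _).trans (h _ z hz w hw hd)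
    · exact (min_le_left _ _).trans (h _ z hz w hw hd)
  -- the fine grid
  obtain ⟨τ₁, hτ₁, hA₁c⟩ := exists_uniform_delta A₁ (show 0 < θ / 4 by positivity)
  obtain ⟨L, hL⟩ := exists_nat_gt (1 / τ₁)
  have hL' : (0 : ℝ) < L := (by positivity : (0 : ℝ) < 1 / τ₁).trans hL
  have hL0 : 0 < L := by exact_mod_cast hL'
  have hL1 : (1 : ℝ) ≤ L := by exact_mod_cast hL0
  have hN1 : (1 : ℝ) ≤ N := by exact_mod_cast hN0
  have hM0 : 0 < N * L := Nat.mul_pos hN0 hL0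
  have hM₁ : 1 / ((N * L : ℕ) : ℝ) < τ₁ := by
    refine lt_of_le_of_lt ?_ ((div_lt_comm₀ hτ₁ hL').1 hL)
    refine one_div_le_one_div_of_le hL' ?_
    push_cast
    exact le_mul_of_one_le_left hL'.le hN1
  have hM₂ : 2 / ((N * L : ℕ) : ℝ) ≤ 2 / N := by
    refine div_le_div_of_nonneg_left (by norm_num) hN' ?_
    push_cast
    exact le_mul_of_one_le_right hN'.le hL1
  -- The second move is so small compared with `θ` that the almost-embedding of the coarse grid
  -- survives, while the fine grids of the two maps become disjoint.
  obtain ⟨A₂, hA₂, hdisj⟩ := H.exists_approx_grid hI hM0 A₁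
    (show 0 < min (θ / 8) (δ₀ / 10) from lt_min (by positivity) (by positivity))
  have hA₂θ : ∀ s z, dist (A₂ s z) (A₁ s z) < θ / 8 := fun s z => (hA₂ s z).trans_le (min_le_left _ _)
  have hA₂A : ∀ s z, dist (A₂ s z) (A s z) < δ₀ / 5 := fun s z => by
    linarith [dist_triangle (A₂ s z) (A₁ s z) (A s z), hA₁ s z,
      (hA₂ s z).trans_le (min_le_right _ _)]
  have hsmall : ∀ s b, ∀ z ∈ gridSet N, ∀ w ∈ gridSet N,
      (∃ u ∈ closedCell (N * L) b, A₂ s u = A₂ (!s) z) →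
      (∃ u ∈ closedCell (N * L) b, A₂ s u = A₂ (!s) w) → dist z w < 1 / (4 * N) := by
    rintro s b z hz w hw ⟨u, hu, huz⟩ ⟨u', hu', huw⟩
    by_contra! hd
    have h1 := hsep (!s) z hz w hw hd
    have h2 := hA₁c s u u' ((dist_le_of_mem_closedCell hu hu').trans_lt hM₁)
    have h4 := dist_triangle4_left (A₂ (!s) z) (A₂ (!s) w) (A₁ (!s) z) (A₁ (!s) w)
    have h6 := dist_triangle4 (A₂ s u) (A₁ s u) (A₁ s u') (A₂ s u')
    rw [← huz, ← huw] at h4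
    have g1 := hA₂θ s u
    have g2 := hA₂θ s u'
    have g3 := hA₂θ (!s) z
    have g4 := hA₂θ (!s) w
    rw [← huz] at g3
    rw [← huw] at g4
    rw [dist_comm (A₁ s u') (A₂ s u')] at h6
    -- Two coincidences in one cell put `A₁ (!s) z` and `A₁ (!s) w` within `θ/4 + 4 * (θ/8) = 3θ/4`
    -- of each other, against `hsep`.
    linarith
  have hω : ∀ s z w, dist z w ≤ 2 / (N : ℝ) → dist (A₂ s z) (A₂ s w) ≤ δ₀ / 2 := by
    intro s z w h
    have h1 := hA s z w (h.trans_lt ((by gcongr; norm_num : 2 / (N : ℝ) < 4 / N).trans h4τ))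
    have h2 := dist_triangle4 (A₂ s z) (A s z) (A s w) (A₂ s w)
    rw [dist_comm (A s w)] at h2
    linarith [hA₂A s z, hA₂A s w]
  -- the staircase
  obtain ⟨π, w, hw0, hw1, hw, hπ⟩ := exists_square_collapse hM0
  have hπ' : ∀ z, dist (π z) z ≤ 2 / N := fun z => (hπ z).trans hM₂
  obtain ⟨m, l, δ, ρ, hδ, hδε, hδρ, hm, hmm, hll, hlm, hlm'⟩ := exists_cell_levels (L := L)
    (fun β : Bool × (Fin N × Fin N) => c β.1 (cellMap N β.2.1 0, cellMap N β.2.2 0))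
    (show 0 < ε / 10 by positivity)
  have hlam : ∀ s z, |∑ b, w b z * l (s, b) - c s z| ≤ 3 * (ε / 10) := by
    intro s z
    refine abs_sum_mul_sub_le (fun b => w b z) (fun b => l (s, b)) (fun b => hw0 b z) (hw1 z)
      fun b hb => ?_
    have h1 := closedCell_subset_divNat hL0 b (hw b z hb)
    have h2 := dist_le_of_mem_closedCell (corner_mem_closedCell _) h1
    have h3 : dist ((cellMap N b.1.divNat 0, cellMap N b.2.divNat 0) : I × I) z < τ' := by
      refine lt_of_le_of_lt ?_ h4τ'
      have e : 4 / (N : ℝ) = 1 / N + 2 / N + 1 / N := by ring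
      have : 0 < 1 / (N : ℝ) := by positivity
      linarith [dist_triangle ((cellMap N b.1.divNat 0, cellMap N b.2.divNat 0) : I × I) (π z) z,
        hπ' z]
    have h4 := hc s _ _ h3
    rw [Real.dist_eq, abs_lt] at h4
    have h5 := abs_lt.1 (hm (s, b.1.divNat, b.2.divNat))
    have h6 := abs_lt.1 (hlm' s b)
    rw [abs_le]
    constructor <;> linarith [h4.1, h4.2, h5.1, h5.2, h6.1, h6.2]
  -- Inside an open coarse cell the level stays within `ρ / 2` of the level of that cell, whereas
  -- the levels of the other map's coarse cells are at least `2ρ` away.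
  have hΓ : ∀ s z b, |∑ c, w c z * l (s, c) - l (!s, b)| < δ → π z ∈ gridSet N := by
    intro s z b hb
    by_contra hz
    obtain ⟨B, hB⟩ := exists_mem_openCell hN0 hz
    have h1 : |∑ c, w c z * l (s, c) - m (s, B)| ≤ ρ / 2 := by
      refine abs_sum_mul_sub_le (fun b => w b z) (fun b => l (s, b)) (fun b => hw0 b z) (hw1 z)
        fun c hc => ?_
      have := eq_of_mem_openCell_of_mem_closedCell hB (closedCell_subset_divNat hL0 c (hw c z hc))
      rw [← this]
      exact (hlm s c).le
    have h2 := hmm (s, B) (!s, b.1.divNat, b.2.divNat) (by simp)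
    have h3 := hlm (!s) b
    have h4 := dist_triangle4 (m (s, B)) (∑ c, w c z * l (s, c)) (l (!s, b))
      (m (!s, b.1.divNat, b.2.divNat))
    simp only [Real.dist_eq] at h4
    rw [abs_sub_comm (m (s, B)) (∑ c, w c z * l (s, c))] at h4
    linarith
  obtain ⟨g, Lv, hg, hLv, hgA, hLl, hfin⟩ := H.exists_disjoint_staircases ha hM0 hN0
    (gridSet_subset_mul N L) A₂ (fun s z hz w hw => hdisj s (!s) z hz w hw (Or.inl (by simp)))
    hsmall (by positivity) hω (show 0 < δ₀ / 10 by positivity) π w hw1 hw l hδ hll hΓ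
  -- The budget is `6/10` for the displacement, `2/10` for `A₂` against `A` and `1/10` for the
  -- collapse, in units of `δ₀`.
  have hclose : ∀ s z, ‖g s z - k (A s z)‖ < δ₀ := by
    intro s z
    have h1 := hA s (π z) z ((hπ' z).trans_lt
      ((by gcongr; norm_num : 2 / (N : ℝ) < 4 / N).trans h4τ))
    have h2 := hA₂A s (π z)
    have e : g s z - k (A s z) = (g s z - k (A₂ s (π z))) + (k (A₂ s (π z)) - k (A s (π z))) +
      (k (A s (π z)) - k (A s z)) := by abel
    rw [e]
    refine (norm_add₃_le).trans_lt ?_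
    rw [H.norm_sub, H.norm_sub]
    linarith [hgA s z]
  have hmap : ∀ s, ∃ F : C(I × I, X × ℝ), (∀ z, F z = (r (g s z), Lv s z)) ∧
      ∀ z, dist (F z) (f s z) < ε := by
    intro s
    obtain ⟨F, hF, hFA⟩ := hr s (g s) (hg s) (hclose s)
    refine ⟨F.prodMk ⟨Lv s, hLv s⟩, fun z => Prod.ext (hF z) rfl, fun z => max_lt (hFA z) ?_⟩
    have h1 := abs_lt.1 (hLl s z)
    have h2 := abs_le.1 (hlam s z)
    change dist (Lv s z) (c s z) < ε
    rw [Real.dist_eq, abs_lt]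
    constructor <;> linarith [h1.1, h1.2, h2.1, h2.2]
  obtain ⟨F₁, hF₁, hd₁⟩ := hmap true
  obtain ⟨F₂, hF₂, hd₂⟩ := hmap false
  refine ⟨F₁, F₂, hd₁, hd₂, ?_⟩
  rw [Set.disjoint_left]
  rintro _ ⟨z, rfl⟩ ⟨z', he⟩
  rw [hF₁, hF₂, Prod.mk.injEq] at he
  exact hfin z z' he.1.symm he.2.symm

/-! ### 1-complexes as finite unions of arcs -/

section SegmentParameter

variable {V : Type*} [NormedAddCommGroup V] [InnerProductSpace ℝ V]

/-- The affine parameter, clamped to `[0, 1]`, of the orthogonal projection to the line from `a`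
to `b`. -/
noncomputable def segmentParam (a b : V) : C(V, I) :=
  ⟨fun x => unitClamp (inner ℝ (x - a) (b - a) / ‖b - a‖ ^ 2), by fun_prop⟩

theorem segmentParam_lineMap {a b : V} (h : a ≠ b) (u : I) :
    segmentParam a b (AffineMap.lineMap a b (u : ℝ)) = u := by
  have hb : ‖b - a‖ ≠ 0 := norm_ne_zero_iff.2 (sub_ne_zero.2 h.symm)
  have : inner ℝ (AffineMap.lineMap a b (u : ℝ) - a) (b - a) / ‖b - a‖ ^ 2 = (u : ℝ) := by
    rw [AffineMap.lineMap_apply_module', add_sub_cancel_right, real_inner_smul_left,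
      real_inner_self_eq_norm_sq]
    field_simp
  change unitClamp _ = u
  rw [this, unitClamp_coe]

theorem lineMap_segmentParam_lineMap (a b : V) (u : I) :
    AffineMap.lineMap a b (segmentParam a b (AffineMap.lineMap a b (u : ℝ)) : ℝ) =
      AffineMap.lineMap a b (u : ℝ) := by
  rcases eq_or_ne a b with rfl | h
  · simp
  · rw [segmentParam_lineMap h]

end SegmentParameter

theorem Finset.Nonempty.exists_eq_pair {α : Type*} {s : Finset α} (hs : s.Nonempty)
    (h : s.card ≤ 2) : ∃ a b, (s : Set α) = {a, b} := by
  classical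
  have h1 := hs.card_pos
  obtain h | h : s.card = 1 ∨ s.card = 2 := by omega
  · obtain ⟨a, rfl⟩ := Finset.card_eq_one.1 h
    exact ⟨a, a, by simp⟩
  · obtain ⟨a, b, -, rfl⟩ := Finset.card_eq_two.1 h
    exact ⟨a, b, by simp⟩

theorem ArcCovered.compactSpace {Z : Type w} [TopologicalSpace Z] (h : ArcCovered Z) :
    CompactSpace Z := by
  obtain ⟨ι, _, φ, -, -, hφ⟩ := h
  have : (⋃ i, Set.range (φ i)) = Set.univ := Set.eq_univ_of_forall fun z => by
    obtain ⟨i, u, h⟩ := hφ z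
    exact Set.mem_iUnion.2 ⟨i, u, h⟩
  exact ⟨this ▸ isCompact_iUnion fun i => isCompact_range (φ i).continuous⟩

/-- Each face spans a segment, degenerate for a vertex, and the clamped orthogonal projection
retracts the complex onto it. -/
theorem IsOneComplex.arcCovered {n : ℕ}
    {K : Geometry.SimplicialComplex ℝ (EuclideanSpace ℝ (Fin n))} (hK : IsOneComplex K) :
    ArcCovered K.space := by
  choose a b hab using fun s : K.faces =>
    (K.nonempty_of_mem_faces s.2).exists_eq_pair (hK.2 s s.2)
  have hseg : ∀ s : K.faces, convexHull ℝ (s.1 : Set (EuclideanSpace ℝ (Fin n))) =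
      AffineMap.lineMap (a s) (b s) '' Set.Icc (0 : ℝ) 1 := fun s => by
    rw [hab, convexHull_pair, segment_eq_image_lineMap]
  have := hK.1.fintype
  let t : Fin (Fintype.card K.faces) ≃ K.faces := (Fintype.equivFin _).symm
  refine ⟨_, inferInstance, fun i => ⟨fun u => ⟨AffineMap.lineMap (a (t i)) (b (t i)) (u : ℝ), ?_⟩,
    ?_⟩, fun i => (segmentParam (a (t i)) (b (t i))).comp ⟨Subtype.val, continuous_subtype_val⟩,
    fun i u => Subtype.ext (lineMap_segmentParam_lineMap _ _ u), fun z => ?_⟩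
  · exact K.convexHull_subset_space (t i).2 (hseg (t i) ▸ Set.mem_image_of_mem _ u.2)
  · exact Continuous.subtype_mk (AffineMap.lineMap_continuous.comp continuous_subtype_val) _
  · obtain ⟨s, hs, hz⟩ := Geometry.SimplicialComplex.mem_space_iff.1 z.2
    rw [hseg ⟨s, hs⟩] at hz
    obtain ⟨u, hu, h⟩ := hz
    exact ⟨t.symm ⟨s, hs⟩, ⟨u, hu⟩, Subtype.ext (by simpa using h)⟩

/-- Some `1`-complex on the line is an arc. -/
theorem exists_isOneComplex_retract_unitInterval :
    ∃ K : Geometry.SimplicialComplex ℝ (EuclideanSpace ℝ (Fin 1)), IsOneComplex K ∧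
      ∃ (θ : C(I, K.space)) (θ' : C(K.space, I)), ∀ u, θ' (θ u) = u := by
  classical
  obtain ⟨a, b, hne⟩ := exists_pair_ne (EuclideanSpace ℝ (Fin 1))
  have hind : AffineIndependent ℝ (Subtype.val : ((({a, b} : Finset (EuclideanSpace ℝ (Fin 1))) :
      Set (EuclideanSpace ℝ (Fin 1)))) → EuclideanSpace ℝ (Fin 1)) := by
    have := (affineIndependent_of_ne ℝ hne).range
    rwa [Matrix.range_cons_cons_empty, ← Finset.coe_pair] at this
  let K : Geometry.SimplicialComplex ℝ (EuclideanSpace ℝ (Fin 1)) :=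
    .ofErase {s | s ⊆ {a, b}} (fun s hs => hind.mono (Finset.coe_subset.2 hs))
      (fun s t hts hs => hts.trans hs) fun s hs t ht =>
        (hind.convexHull_inter hs ht).symm.subset.trans (by rfl)
  have hK : IsOneComplex K :=
    ⟨((Finset.finite_toSet (Finset.powerset {a, b})).subset fun s hs =>
      Finset.mem_coe.2 (Finset.mem_powerset.2 hs.1)),
      fun s hs => (Finset.card_le_card hs.1).trans Finset.card_le_two⟩
  have hf : ({a, b} : Finset _) ∈ K.faces := ⟨Finset.Subset.refl _, by simp⟩
  refine ⟨K, hK, ⟨fun u => ⟨AffineMap.lineMap a b (u : ℝ), K.convexHull_subset_space hf ?_⟩,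
    Continuous.subtype_mk (AffineMap.lineMap_continuous.comp continuous_subtype_val) _⟩,
    (segmentParam a b).comp ⟨Subtype.val, continuous_subtype_val⟩,
    fun u => segmentParam_lineMap hne u⟩
  rw [Finset.coe_pair, convexHull_pair, segment_eq_image_lineMap]
  exact Set.mem_image_of_mem _ u.2

/-! ### The elementary implications and the theorem -/

namespace TopographicalPair

variable {X : Type u} [TopologicalSpace X] {Z : Type v} [TopologicalSpace Z] {Z' : Type w}
  [TopologicalSpace Z']

/-- Precomposition of a topographical map pair on `Z × I` with a map into `Z`. -/
def precomp (p : TopographicalPair (Z × I) X) (θ : C(Z', Z)) : TopographicalPair (Z' × I) X :=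
  ⟨p.spatial.comp (θ.prodMap (ContinuousMap.id I)), p.level.comp (θ.prodMap (ContinuousMap.id I))⟩

theorem InCategory.precomp {p : TopographicalPair (Z × I) X} (h : p.InCategory) (θ : C(Z', Z)) :
    (p.precomp θ).InCategory := fun z => h (θ z)

theorem InConstCategory.precomp {p : TopographicalPair (Z × I) X} (h : p.InConstCategory)
    (θ : C(Z', Z)) : (p.precomp θ).InConstCategory :=
  ⟨h.1.precomp θ, fun z => h.2.1 (θ z), fun z => h.2.2 (θ z)⟩

theorem IsDisjoint.of_forall_ne {p₁ : TopographicalPair Z X} {p₂ : TopographicalPair Z' X}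
    (h : ∀ z w, p₁.level z = p₂.level w → p₁.spatial z ≠ p₂.spatial w) : p₁.IsDisjoint p₂ := by
  intro t
  rw [Set.disjoint_left]
  rintro _ ⟨z, hz, rfl⟩ ⟨w, hw, e⟩
  exact h z w (hz.trans hw.symm) e.symm

theorem IsDisjoint.spatial_ne {p₁ : TopographicalPair Z X} {p₂ : TopographicalPair Z' X}
    (h : p₁.IsDisjoint p₂) {z : Z} {w : Z'} (e : p₁.level z = p₂.level w) :
    p₁.spatial z ≠ p₂.spatial w := fun he =>
  Set.disjoint_left.1 (h (p₁.level z)) ⟨z, rfl, rfl⟩ ⟨w, e.symm, he.symm⟩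

end TopographicalPair

open TopographicalPair in
-- Pairs over the arc are pulled back to the complex by the retraction, separated there, and
-- restricted to the arc.
theorem HasKcKStar.hasDcDStar {X : Type u} [MetricSpace X] (h : HasKcKStar X) : HasDcDStar X := by
  obtain ⟨K, hK, θ, θ', hθ⟩ := exists_isOneComplex_retract_unitInterval
  intro p₁ p₂ h₁ h₂ ε hε
  obtain ⟨q₁, q₂, c₁, c₂, d₁, d₂, hd⟩ :=
    h 1 1 K K hK hK (p₁.precomp θ') (p₂.precomp θ') (h₁.precomp θ') (h₂.precomp θ') ε hε
  refine ⟨q₁.precomp θ, q₂.precomp θ, c₁.precomp θ, c₂.precomp θ, fun z => ?_, fun z => ?_,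
    IsDisjoint.of_forall_ne fun z w => hd.spatial_ne⟩
  · simpa [precomp, Prod.map, hθ] using d₁ (θ z.1, z.2)
  · simpa [precomp, Prod.map, hθ] using d₂ (θ z.1, z.2)

theorem HasDDStar.hasDcDStar {X : Type u} [MetricSpace X] (h : HasDDStar X) : HasDcDStar X :=
  fun p₁ p₂ h₁ h₂ => h p₁ p₂ h₁.1 h₂

/-- A path concordance is a pair `(f, τ)` read as one map to `X × I`; disjoint images mean
disjointness at every level. -/
theorem hasDDStar_iff_hasDisjointConcordances {X : Type u} [MetricSpace X] :
    HasDDStar X ↔ HasDisjointConcordances X := by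
  constructor
  · intro h f₁ f₂ ε hε
    obtain ⟨q₁, q₂, c₁, c₂, d₁, d₂, hd⟩ := h ⟨f₁, ContinuousMap.snd⟩ ⟨f₂, ContinuousMap.snd⟩
      (fun _ => ⟨rfl, rfl⟩) (fun _ => ⟨rfl, rfl⟩) ε hε
    refine ⟨q₁.spatial.prodMk q₁.level, q₂.spatial.prodMk q₂.level, c₁, c₂,
      Set.disjoint_range_iff.2 fun z w e => ?_, fun z => dist_comm (f₁ z) _ ▸ d₁ z,
      fun z => dist_comm (f₂ z) _ ▸ d₂ z⟩
    exact hd.spatial_ne (congrArg Prod.snd e) (congrArg Prod.fst e)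
  · intro h p₁ p₂ _ _ ε hε
    obtain ⟨F₁, F₂, c₁, c₂, hd, d₁, d₂⟩ := h p₁.spatial p₂.spatial ε hε
    exact ⟨⟨ContinuousMap.fst.comp F₁, ContinuousMap.snd.comp F₁⟩,
      ⟨ContinuousMap.fst.comp F₂, ContinuousMap.snd.comp F₂⟩, c₁, c₂,
      fun z => dist_comm (p₁.spatial z) _ ▸ d₁ z, fun z => dist_comm (p₂.spatial z) _ ▸ d₂ z,
      TopographicalPair.IsDisjoint.of_forall_ne fun z w e e' =>
        Set.disjoint_range_iff.1 hd z w (Prod.ext e' e)⟩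

theorem HasDcDStar.hasDDP_prod_real {X : Type u} [MetricSpace X] [LocallyCompactSpace X]
    [TopologicalSpace.SeparableSpace X] (hANR : IsANR X) (hDAP : HasDAP X) (h : HasDcDStar X) :
    HasDDP (X × ℝ) := by
  rcases isEmpty_or_nonempty X with hX | hX
  · exact fun f => (hX.false (f ⟨0, by simp⟩).1).elim
  · obtain ⟨E, _, _, k, r, H⟩ := hANR.exists_isNbhdRetraction
    exact .of_approxDisjoint_square
      (H.approxDisjoint_prod_real (HasDisjointDisks.approxDisjoint_unitInterval hDAP) h)

theorem HasDDP.starSeparable {X : Type u} [MetricSpace X] [LocallyCompactSpace X]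
    [TopologicalSpace.SeparableSpace X] (hANR : IsANR X) (hDAP : HasDAP X) (h : HasDDP (X × ℝ))
    {Z₁ Z₂ : Type w} [TopologicalSpace Z₁] [T2Space Z₁] [TopologicalSpace Z₂] [T2Space Z₂]
    (hZ₁ : ArcCovered Z₁) (hZ₂ : ArcCovered Z₂) {p₁ : TopographicalPair (Z₁ × I) X}
    {p₂ : TopographicalPair (Z₂ × I) X} (h₁ : p₁.InCategory) (h₂ : p₂.InCategory) :
    StarSeparable p₁ p₂ := by
  rcases isEmpty_or_nonempty X with hX | hX
  · exact fun ε hε => ⟨p₁, p₂, h₁, h₂, fun z => (hX.false (p₁.spatial z)).elim,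
      fun z => (hX.false (p₂.spatial z)).elim, .of_forall_ne fun z => (hX.false (p₁.spatial z)).elim⟩
  · have := hZ₁.compactSpace
    have := hZ₂.compactSpace
    obtain ⟨E, _, _, k, r, H⟩ := hANR.exists_isNbhdRetraction
    exact H.starSeparable (HasDisjointDisks.approxDisjoint_unitInterval hDAP)
      (HasDisjointDisks.approxDisjoint_square h) hZ₁ hZ₂ p₁ p₂

theorem mainTheorem1 (X : Type u) [MetricSpace X] [LocallyCompactSpace X]
    [TopologicalSpace.SeparableSpace X] (hANR : IsANR X) (hDAP : HasDAP X) :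
    List.TFAE [HasKcKStar X, HasDDStar X, HasDisjointConcordances X, HasDDP (X × ℝ)] ∧
      (HasDisjointDisks 0 2 X →
        List.TFAE [HasDcDStar X, HasKcKStar X, HasDDStar X, HasDisjointConcordances X,
          HasDDP (X × ℝ)]) := by
  have hae : HasDcDStar X → HasDDP (X × ℝ) := HasDcDStar.hasDDP_prod_real hANR hDAP
  have heb : HasDDP (X × ℝ) → HasKcKStar X := fun h m n K₁ K₂ hK₁ hK₂ p₁ p₂ h₁ h₂ =>
    h.starSeparable hANR hDAP hK₁.arcCovered hK₂.arcCovered h₁.1 h₂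
  have hec : HasDDP (X × ℝ) → HasDDStar X := fun h p₁ p₂ h₁ h₂ =>
    h.starSeparable hANR hDAP arcCovered_unitInterval arcCovered_unitInterval h₁ h₂
  have hcd : HasDDStar X ↔ HasDisjointConcordances X := hasDDStar_iff_hasDisjointConcordances
  have hba : HasKcKStar X → HasDcDStar X := HasKcKStar.hasDcDStar
  have hca : HasDDStar X → HasDcDStar X := HasDDStar.hasDcDStar
  refine ⟨?_, fun _ => ?_⟩
  -- Although (a) is not in this list, it is the intermediate statement through which both (b) and
  -- (c) reach (e).
  · tfae_have 1 → 4 := fun h => hae (hba h)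
    tfae_have 4 → 1 := heb
    tfae_have 2 → 4 := fun h => hae (hca h)
    tfae_have 4 → 2 := hec
    tfae_have 2 ↔ 3 := hcd
    tfae_finish
  · tfae_have 1 → 5 := hae
    tfae_have 5 → 2 := heb
    tfae_have 2 → 1 := hba
    tfae_have 5 → 3 := hec
    tfae_have 3 → 1 := hca
    tfae_have 3 ↔ 4 := hcd
    tfae_finish
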